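/- Fix integers $p\ge 2$ and $K\ge 1$. Let $\mathcal S^{p-1}$ be the unit sphere of $\mathbb R^p$ with surface area measure $\sigma_p$, and $\boldsymbol\theta_0=(0,\dots,0,1)'\in\mathbb R^p$. Let $f:\mathbb R\to[0,\infty)$ be an angular function, that is, a measurable function with $f(0)=1$, and assume that $f$ is continuous at $0$. Let $(\kappa_n)$ be a sequence of positive real numbers with $\kappa_n\to 0$. For every $n$, let $\mathrm P^{(n)}_{\kappa_n,f}$ denote the hypothesis under which $\mathbf U_1,\dots,\mathbf U_n$ are independent random vectors with the rotationally symmetric distribution on $\mathcal S^{p-1}$ whose density with respect to $\sigma_p$ is proportional to $\mathbf u\mapsto f(\kappa_n\mathbf u'\boldsymbol\theta_0)$ (it is assumed that these distributions exist, that is, that $0<\int_{\mathcal S^{p-1}}f(\kappa_n\mathbf u'\boldsymbol\theta_0)\,\mathrm d\sigma_p(\mathbf u)<\infty$), and let $\mathrm E^{(n)}_{\kappa_n,f}$ denote the corresponding expectation. For $\mathbf x\in\mathcal S^{p-1}$ use the hyperspherical coordinates $x_1=\sin\theta_{p-1}\cdots\sin\theta_2\sin\theta_1$, $x_2=\sin\theta_{p-1}\cdots\sin\theta_2\cos\theta_1$,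 $x_{i+1}=\sin\theta_{p-1}\cdots\sin\theta_{i+1}\cos\theta_i$ for $2\le i\le p-1$ (so $x_p=\cos\theta_{p-1}$ if $p\ge 3$), with $\theta_1$ taken modulo $2\pi$ and $\theta_j\in[0,\pi]$ for $j\ge 2$. For $k\ge 1$ let $\mathcal M_k=\{\mathbf m\in\mathbb N_0^p: m_1+\dots+m_p=k,\ m_p\in\{0,1\}\}$, write $|\mathbf m^{j}|=m_j+\dots+m_p$, $\lambda_j=|\mathbf m^{j+1}|+(p-j-1)/2$ and $(a)_\ell=a(a+1)\cdots(a+\ell-1)$, and let $$\varphi_{\mathbf m}(\mathbf x)=\sqrt{B_{\mathbf m}}\;\zeta_{\mathbf m}(\theta_1)\prod_{j=1}^{p-2}(\sin\theta_{p-j})^{|\mathbf m^{j+1}|}\,C_{m_j}^{\lambda_j}(\cos\theta_{p-j}),$$ where $\zeta_{\mathbf m}(s)=\cos(m_{p-1}s)$ if $m_p=0$ and $\zeta_{\mathbf m}(s)=\sin((m_{p-1}+1)s)$ if $m_p=1$, where $$B_{\mathbf m}=b_{\mathbf m}\prod_{j=1}^{p-2}\frac{m_j!\,\big(\tfrac{p-j+1}{2}\big)_{|\mathbf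 m^{j+1}|}(m_j+\lambda_j)}{(2\lambda_j)_{m_j}\big(\tfrac{p-j}{2}\big)_{|\mathbf m^{j+1}|}\lambda_j},\qquad b_{\mathbf m}=\begin{cases}2&\text{if }m_{p-1}+m_p>0,\\1&\text{otherwise,}\end{cases}$$ and where $C_q^\lambda(t)=\sum_{j=0}^{\lfloor q/2\rfloor}(-1)^j\frac{2^{q-2j}\Gamma(q-j+\lambda)}{\Gamma(\lambda)\,j!\,(q-2j)!}t^{q-2j}$ is the Gegenbauer polynomial. (For $p=2$ these functions are $\sqrt2\cos(k\theta_1)$ and $\sqrt2\sin(k\theta_1)$; for every $p\geq 2$, $\{\varphi_{\mathbf m}:\mathbf m\in\mathcal M_k\}$ is the classical orthonormal basis of the spherical harmonics of degree $k$, whose cardinality is $d_{p,k}$.) Let $\mathbf G_{p,k}=(\varphi_{\mathbf m})_{\mathbf m\in\mathcal M_k}:\mathcal S^{p-1}\to\mathbb R^{d_{p,k}}$ (the ordering of $\mathcal M_k$ is immaterial), and $$\mathbf T^{(n)}_{p,K}=\frac1n\sum_{i=1}^n\big((\mathbf G_{p,1}(\mathbf U_i))',\dots,(\mathbf G_{p,K}(\mathbf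 U_i))'\big)'.$$ Then, under $\mathrm P^{(n)}_{\kappa_n,f}$, as $n\to\infty$, $$\sqrt n\,\big(\mathbf T^{(n)}_{p,K}-\mathrm E^{(n)}_{\kappa_n,f}[\mathbf T^{(n)}_{p,K}]\big)$$ converges in distribution to the standard normal distribution $\mathcal N(\mathbf 0,\mathbf I_d)$ on $\mathbb R^d$, where $d=d_{p,1}+\dots+d_{p,K}$. -/

import Mathlib

set_option linter.unusedSimpArgs false
open MeasureTheory ProbabilityTheory Filter Topology

noncomputable section

/-- The unit sphere `S^{p-1}` of the Euclidean space `ℝ^p`. -/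
abbrev USphere (p : ℕ) : Type := Metric.sphere (0 : EuclideanSpace ℝ (Fin p)) 1

/-! ### Hyperspherical coordinates

Coordinates of `ℝ^p` are indexed by `0, …, p-1`, so that the entry of index `i` is the entry
usually written `x_{i+1}`. The angles of a point are `θ_1, …, θ_{p-1}`, with
`x_{i+1} = sin θ_{p-1} ⋯ sin θ_{i+1} cos θ_i` for `i ≥ 1` and
`x_1 = sin θ_{p-1} ⋯ sin θ_1`. -/

/-- `(x_1² + ⋯ + x_{i+1}²)^{1/2}`. -/
def headNorm {p : ℕ} (x : EuclideanSpace ℝ (Fin p)) (i : Fin p) : ℝ :=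
  Real.sqrt (∑ l with l ≤ i, x l ^ 2)

/-- The angle `θ_1`, with `x_1 = r sin θ_1` and `x_2 = r cos θ_1` (determined modulo `2π`). -/
def azimuth {p : ℕ} (hp : 2 ≤ p) (x : EuclideanSpace ℝ (Fin p)) : ℝ :=
  Complex.arg ⟨x ⟨1, by omega⟩, x ⟨0, by omega⟩⟩

/-- The angle `θ_i ∈ [0, π]`, for `i = 2, …, p-1`. -/
def polarAngle {p : ℕ} (x : EuclideanSpace ℝ (Fin p)) (i : Fin p) : ℝ :=
  Real.arccos (x i / headNorm x i)

theorem headNorm_mul_cos {p : ℕ} (x : EuclideanSpace ℝ (Fin p)) (i : Fin p) :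
    headNorm x i * Real.cos (polarAngle x i) = x i := by
  have hle : |x i| ≤ headNorm x i := Real.abs_le_sqrt
    (Finset.single_le_sum (f := fun l => x l ^ 2) (fun l _ => sq_nonneg _) (by simp))
  have h0 : 0 ≤ headNorm x i := Real.sqrt_nonneg _
  obtain ⟨h1, h2⟩ := abs_le.1 hle
  rcases h0.eq_or_lt with h | h
  · rw [← h] at h1 h2 ⊢
    linarith
  · rw [polarAngle, Real.cos_arccos, mul_div_cancel₀ _ h.ne']
    · rw [le_div_iff₀ h]; linarith
    · rw [div_le_one h]; exact h2

theorem headNorm_mul_sin {p : ℕ} (x : EuclideanSpace ℝ (Fin p)) (i j : Fin p)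
    (hij : j.val = i.val + 1) :
    headNorm x j * Real.sin (polarAngle x j) = headNorm x i := by
  have hs : 0 ≤ Real.sin (polarAngle x j) := by
    rw [polarAngle, Real.sin_arccos]; exact Real.sqrt_nonneg _
  have h0 : ∀ l, 0 ≤ headNorm x l := fun l => Real.sqrt_nonneg _
  have hsq : ∀ l, headNorm x l ^ 2 = ∑ a with a ≤ l, x a ^ 2 := fun l =>
    Real.sq_sqrt (Finset.sum_nonneg fun _ _ => sq_nonneg _)
  have hset : Finset.univ.filter (fun a => a ≤ j) =
      insert j (Finset.univ.filter fun a => a ≤ i) := by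
    ext a
    simp only [Finset.mem_filter, Finset.mem_univ, true_and, Finset.mem_insert,
      Finset.mem_singleton, Finset.notMem_empty, Fin.le_def, Fin.lt_def, Fin.ext_iff]
    omega
  have hstep : headNorm x j ^ 2 = x j ^ 2 + headNorm x i ^ 2 := by
    rw [hsq, hsq, hset, Finset.sum_insert (by simp [Fin.lt_def, -Fin.val_fin_lt, hij])]
  rw [← sq_eq_sq₀ (mul_nonneg (h0 j) hs) (h0 i)]
  have hc := headNorm_mul_cos x j
  have := Real.sin_sq_add_cos_sq (polarAngle x j)
  have h3 : headNorm x j ^ 2 * Real.cos (polarAngle x j) ^ 2 = x j ^ 2 := by rw [← mul_pow, hc]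
  nlinarith

theorem headNorm_eq_prod_sin {p : ℕ} (x : USphere p) (i : Fin p) :
    headNorm x.1 i = ∏ l with i < l, Real.sin (polarAngle x.1 l) := by
  obtain ⟨d, hd⟩ : ∃ d, i.val + d + 1 = p := ⟨p - 1 - i, by omega⟩
  induction d generalizing i with
  | zero =>
    have h1 : Finset.univ.filter (fun l : Fin p => i < l) = ∅ :=
      Finset.filter_eq_empty_iff.2 fun l _ => by rw [Fin.lt_def]; omega
    have h2 : Finset.univ.filter (fun l : Fin p => l ≤ i) = Finset.univ :=
      Finset.filter_eq_self.2 fun l _ => by rw [Fin.le_def]; omega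
    have h3 : ‖x.1‖ = 1 := by simp
    rw [EuclideanSpace.norm_eq] at h3
    simpa [h1, headNorm, h2] using h3
  | succ d ih =>
    have h := ih ⟨i + 1, by omega⟩ (by simp only; omega)
    have hset : Finset.univ.filter (fun l : Fin p => i < l) =
        insert ⟨i + 1, by omega⟩ (Finset.univ.filter fun l => (⟨i + 1, by omega⟩ : Fin p) < l) := by
      ext a
      simp only [Finset.mem_filter, Finset.mem_univ, true_and, Finset.mem_insert,
        Finset.mem_singleton, Finset.notMem_empty, Fin.le_def, Fin.lt_def, Fin.ext_iff]
      omega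
    rw [hset, Finset.prod_insert (by simp), ← h, mul_comm,
      headNorm_mul_sin x.1 i ⟨i + 1, by omega⟩ rfl]

/-- The angles defined above are hyperspherical coordinates of the point `x` of the sphere. -/
theorem hyperspherical_coordinates {p : ℕ} (hp : 2 ≤ p) (x : USphere p) :
    x.1 ⟨0, by omega⟩ =
        (∏ l with (⟨1, by omega⟩ : Fin p) < l, Real.sin (polarAngle x.1 l)) *
          Real.sin (azimuth hp x.1) ∧
      x.1 ⟨1, by omega⟩ =
        (∏ l with (⟨1, by omega⟩ : Fin p) < l, Real.sin (polarAngle x.1 l)) *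
          Real.cos (azimuth hp x.1) ∧
      ∀ i : Fin p, 2 ≤ i.val →
        x.1 i = (∏ l with i < l, Real.sin (polarAngle x.1 l)) * Real.cos (polarAngle x.1 i) := by
  have key : headNorm x.1 ⟨1, by omega⟩ =
      ‖(⟨x.1 ⟨1, by omega⟩, x.1 ⟨0, by omega⟩⟩ : ℂ)‖ := by
    have hset : Finset.univ.filter (fun l : Fin p => l ≤ ⟨1, by omega⟩) =
        {⟨1, by omega⟩, ⟨0, by omega⟩} := by
      ext a
      simp only [Finset.mem_filter, Finset.mem_univ, true_and, Finset.mem_insert,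
        Finset.mem_singleton, Finset.notMem_empty, Fin.le_def, Fin.lt_def, Fin.ext_iff]
      omega
    rw [headNorm, hset, Finset.sum_pair (by simp), Complex.norm_def, Complex.normSq_mk]
    congr 1; ring
  simp only [← headNorm_eq_prod_sin, headNorm_mul_cos, key, azimuth, Complex.norm_mul_sin_arg,
    Complex.norm_mul_cos_arg, implies_true, and_self]

/-! ### The basis of spherical harmonics -/

/-- The Gegenbauer polynomial `C_q^λ`, for `λ > 0`. -/
def gegenbauer (lam : ℝ) (q : ℕ) (t : ℝ) : ℝ :=
  ∑ j ∈ Finset.range (q / 2 + 1),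
    (-1) ^ j *
      (2 ^ (q - 2 * j) * Real.Gamma ((q : ℝ) - j + lam) /
        (Real.Gamma lam * (j.factorial : ℝ) * ((q - 2 * j).factorial : ℝ))) *
      t ^ (q - 2 * j)

/-- The Pochhammer symbol `(a)_k = a (a + 1) ⋯ (a + k - 1)`. -/
def pochhammerSymbol (a : ℝ) (k : ℕ) : ℝ := ∏ i ∈ Finset.range k, (a + i)

/-- The set `M_k` of the multi-indices `m = (m_1, …, m_p)` with `m_1 + ⋯ + m_p = k` and
`m_p ∈ {0, 1}`. -/
def multiIdx (p k : ℕ) : Finset (Fin p → ℕ) :=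
  (Finset.univ.piAntidiag k).filter fun m => ∀ i : Fin p, i.val + 1 = p → m i = 0 ∨ m i = 1

/-- `m_{j+2} + ⋯ + m_p`, that is, the sum of the entries after the entry of index `j`. -/
def tailSum {p : ℕ} (m : Fin p → ℕ) (j : Fin p) : ℕ := ∑ i with j < i, m i

/-- The parameter `λ_{j+1} = |m^{j+2}| + (p - (j+1) - 1) / 2`. -/
def gegParam {p : ℕ} (m : Fin p → ℕ) (j : Fin p) : ℝ :=
  (tailSum m j : ℝ) + ((p : ℝ) - ((j : ℕ) + 1) - 1) / 2

/-- `ζ_m(s)`, which is `cos (m_{p-1} s)` if `m_p = 0` and `sin ((m_{p-1} + 1) s)` otherwise. -/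
def zetaFun {p : ℕ} (hp : 2 ≤ p) (m : Fin p → ℕ) (s : ℝ) : ℝ :=
  if m ⟨p - 1, by omega⟩ = 0 then Real.cos ((m ⟨p - 2, by omega⟩ : ℝ) * s)
  else Real.sin (((m ⟨p - 2, by omega⟩ : ℝ) + 1) * s)

/-- The normalizing constant `B_m`. The product is over the entries `m_1, …, m_{p-2}`. -/
def normConst {p : ℕ} (hp : 2 ≤ p) (m : Fin p → ℕ) : ℝ :=
  (if 0 < m ⟨p - 2, by omega⟩ + m ⟨p - 1, by omega⟩ then 2 else 1) *
    ∏ j : Fin p with j.val + 2 < p,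
      (((m j).factorial : ℝ) *
          pochhammerSymbol (((p : ℝ) - ((j : ℕ) + 1) + 1) / 2) (tailSum m j) *
          ((m j : ℝ) + gegParam m j)) /
        (pochhammerSymbol (2 * gegParam m j) (m j) *
          pochhammerSymbol (((p : ℝ) - ((j : ℕ) + 1)) / 2) (tailSum m j) *
          gegParam m j)

/-- The spherical harmonic `φ_m` on `S^{p-1}`,
`√B_m ζ_m(θ_1) ∏_{j=1}^{p-2} (sin θ_{p-j})^{|m^{j+1}|} C_{m_j}^{λ_j} (cos θ_{p-j})`.
The angle `θ_{p-j}` belongs to the coordinate `j.rev`. For `p = 2` and `k ≥ 1` the product is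
empty, `M_k = {(k, 0), (k - 1, 1)}`, and the functions are `√2 cos (k θ_1)`, `√2 sin (k θ_1)`. -/
def sphHarm {p : ℕ} (hp : 2 ≤ p) (m : Fin p → ℕ) (x : USphere p) : ℝ :=
  Real.sqrt (normConst hp m) * zetaFun hp m (azimuth hp x.1) *
    ∏ j : Fin p with j.val + 2 < p,
      (Real.sin (polarAngle x.1 j.rev) ^ tailSum m j *
        gegenbauer (gegParam m j) (m j) (Real.cos (polarAngle x.1 j.rev)))

/-- The vector `G_{p,k}` of the degree-`k` basis functions. Its `d_{p,k}` coordinates are indexed by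
`M_k` itself instead of by an (arbitrary) enumeration of `M_k`. -/
def sphHarmVec {p : ℕ} (hp : 2 ≤ p) (k : ℕ) (x : USphere p) : EuclideanSpace ℝ (multiIdx p k) :=
  WithLp.toLp 2 fun m => sphHarm hp m.1 x

/-- The coordinates of `T_{p,K}^{(n)}`: pairs of a degree `k ∈ {1, …, K}` and an element of `M_k`. -/
abbrev HarmIdx (p K : ℕ) : Type := Σ k : Finset.Icc 1 K, multiIdx p k

/-- `T_{p,K}^{(n)} = n⁻¹ ∑_i (G_{p,1}(U_i)', …, G_{p,K}(U_i)')'`, a function of the sample. -/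
def harmMean {p : ℕ} (hp : 2 ≤ p) (K : ℕ) {n : ℕ} (u : Fin n → USphere p) :
    EuclideanSpace ℝ (HarmIdx p K) :=
  (n : ℝ)⁻¹ • ∑ i, WithLp.toLp 2 fun a : HarmIdx p K => sphHarmVec hp a.1 (u i) a.2

/-! ### Rotationally symmetric distributions -/

/-- The surface area measure on `S^{p-1}`. -/
def surfaceMeasure (p : ℕ) : Measure (USphere p) :=
  (volume : Measure (EuclideanSpace ℝ (Fin p))).toSphere

/-- The point `θ_0 = (0, …, 0, 1)`. -/
def northPole (p : ℕ) : EuclideanSpace ℝ (Fin p) :=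
  WithLp.toLp 2 fun i => if i.val + 1 = p then 1 else 0

/-- Angular functions: (measurable) functions `f : ℝ → [0, ∞)` with `f 0 = 1`. -/
structure IsAngularFunction (f : ℝ → ℝ) : Prop where
  measurable : Measurable f
  nonneg : ∀ s, 0 ≤ f s
  map_zero : f 0 = 1

/-- The distribution on `S^{p-1}` whose density with respect to the surface area measure is
proportional to `u ↦ f (κ u'θ)`. It is a probability measure whenever the integral of this function
is positive and finite (and it is the zero measure otherwise). -/
def rotSymMeasure (p : ℕ) (θ : EuclideanSpace ℝ (Fin p)) (κ : ℝ) (f : ℝ → ℝ) :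
    Measure (USphere p) :=
  (surfaceMeasure p).withDensity fun u =>
    ENNReal.ofReal (f (κ * inner ℝ u.1 θ)) /
      ∫⁻ v : USphere p, ENNReal.ofReal (f (κ * inner ℝ v.1 θ)) ∂(surfaceMeasure p)

end

noncomputable section

/-! The vectors of spherical harmonics evaluated at the observations form a triangular array with
i.i.d. rows and a bound that does not depend on `n`. After exact centering, a central limit theorem
only requires the covariance matrix of one observation to converge to the identity; no rate for `κ
n` enters. That limit theorem is `tendstoInDistribution_stdGaussian_of_bounded_array`, proved with
characteristic functions.

Since `f` is continuous at `0` with `f 0 = 1`, the density ratio tends to a constant as `κ n → 0`,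
and expectations of bounded functions tend to their uniform means
(`tendsto_integral_rotSymMeasure`). The limiting covariance is therefore the Gram matrix of the
harmonics under the uniform law, and the limiting mean is their pairing with the constant harmonic.

The bulk of the proof is thus `sphHarm_orthonormal`, with the explicit normalizing constants. For a
uniform point of the sphere, the last coordinate is independent of the direction of the others: a
Gaussian weight factors both in polar and in Cartesian coordinates (`sphereMean_initPart_mul`).
Iterating, the mean of a product of functions of the hyperspherical angles is a mean over the circle
times one-dimensional means (`sphereMean_angularProd`). The circle gives trigonometric integrals.
The one-dimensional means are handled algebraically: the moments satisfy a Pearson identity, a form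
of integration by parts, which with the Gegenbauer differential equation gives orthogonality and
with the three-term recurrence gives the norms. -/

/-! ### A central limit theorem for bounded triangular arrays -/

/-- Pointwise second-order Taylor expansion of the exponential, whose linear term integrates to
zero. Boundedness gives a remainder of order `s ^ 3`, which survives multiplication by `n` when `s =
n^(-1/2)`. -/
theorem norm_charFun_smul_sub_le {E : Type*} [NormedAddCommGroup E] [InnerProductSpace ℝ E]
    [MeasurableSpace E] [BorelSpace E] [SecondCountableTopology E]
    (ν : Measure E) [IsProbabilityMeasure ν] {C : ℝ}
    (hb : ∀ᵐ x ∂ν, ‖x‖ ≤ C) (t : E) (h0 : ∫ x, inner ℝ x t ∂ν = 0) {s : ℝ} (hs : 0 ≤ s) :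
    ‖charFun ν (s • t) - (1 - (s ^ 2 / 2 * ∫ x, inner ℝ x t ^ 2 ∂ν : ℝ))‖ ≤
      (s * (C * ‖t‖)) ^ 3 * Real.exp (s * (C * ‖t‖)) := by
  have hin : ∀ᵐ x ∂ν, ‖(inner ℝ x t : ℝ)‖ ≤ C * ‖t‖ := by
    filter_upwards [hb] with x hx
    exact (norm_inner_le_norm x t).trans (by gcongr)
  have i1 : Integrable (fun x => (inner ℝ x t : ℝ)) ν :=
    Integrable.of_bound (by fun_prop) _ hin
  have i2 : Integrable (fun x => (inner ℝ x t : ℝ) ^ 2) ν := by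
    refine Integrable.of_bound (C := (C * ‖t‖) ^ 2) (by fun_prop) ?_
    filter_upwards [hin] with x hx
    rw [norm_pow]; gcongr
  have i3 : Integrable (fun x => Complex.exp ((inner ℝ x (s • t) : ℝ) * Complex.I)) ν := by
    refine Integrable.of_bound (C := 1) (by fun_prop) (ae_of_all _ fun x => ?_)
    rw [Complex.norm_exp_ofReal_mul_I]
  have i4 : Integrable (fun x => ((s * inner ℝ x t : ℝ) : ℂ) * Complex.I) ν :=
    ((i1.const_mul s).ofReal (𝕜 := ℂ)).mul_const _
  have i5 : Integrable (fun x => ((s ^ 2 / 2 * inner ℝ x t ^ 2 : ℝ) : ℂ)) ν :=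
    (i2.const_mul _).ofReal (𝕜 := ℂ)
  have i6 : Integrable (fun x => (1 : ℂ) + ((s * inner ℝ x t : ℝ) : ℂ) * Complex.I) ν :=
    (integrable_const _).add i4
  have i7 : Integrable (fun x => (1 : ℂ) + ((s * inner ℝ x t : ℝ) : ℂ) * Complex.I -
      ((s ^ 2 / 2 * inner ℝ x t ^ 2 : ℝ) : ℂ)) ν := i6.sub i5
  have e : charFun ν (s • t) - (1 - (s ^ 2 / 2 * ∫ x, inner ℝ x t ^ 2 ∂ν : ℝ)) =
      ∫ x, (Complex.exp ((inner ℝ x (s • t) : ℝ) * Complex.I) -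
        (1 + ((s * inner ℝ x t : ℝ) : ℂ) * Complex.I -
          ((s ^ 2 / 2 * inner ℝ x t ^ 2 : ℝ) : ℂ))) ∂ν := by
    have j1 : ∫ x, ((s * inner ℝ x t : ℝ) : ℂ) * Complex.I ∂ν = 0 := by
      rw [integral_mul_const, integral_complex_ofReal, integral_const_mul, h0]; simp
    have j2 : ∫ x, ((s ^ 2 / 2 * inner ℝ x t ^ 2 : ℝ) : ℂ) ∂ν =
        (s ^ 2 / 2 * ∫ x, inner ℝ x t ^ 2 ∂ν : ℝ) := by
      rw [integral_complex_ofReal, integral_const_mul]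
    rw [integral_sub i3 i7, integral_sub i6 i5, integral_add (integrable_const _) i4, j1, j2,
      charFun_apply]
    simp
  rw [e]
  refine (norm_integral_le_of_norm_le_const (C := (s * (C * ‖t‖)) ^ 3 *
    Real.exp (s * (C * ‖t‖))) ?_).trans (by simp)
  filter_upwards [hin] with x hx
  have h := Complex.norm_exp_sub_sum_le_norm_mul_exp (((s * inner ℝ x t : ℝ) : ℂ) * Complex.I) 3
  have hn : ‖((s * inner ℝ x t : ℝ) : ℂ) * Complex.I‖ ≤ s * (C * ‖t‖) := by
    rw [norm_mul, Complex.norm_real, Complex.norm_I, mul_one, norm_mul, Real.norm_of_nonneg hs]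
    gcongr
  calc _ = ‖Complex.exp (((s * inner ℝ x t : ℝ) : ℂ) * Complex.I) -
        ∑ m ∈ Finset.range 3, (((s * inner ℝ x t : ℝ) : ℂ) * Complex.I) ^ m / m.factorial‖ := by
        congr 2
        · rw [inner_smul_right]
        · simp [Finset.sum_range_succ, mul_pow, Nat.factorial]; ring
    _ ≤ _ := h
    _ ≤ _ := by
      have := (norm_nonneg _).trans hn
      gcongr

/-- A central limit theorem for triangular arrays whose rows consist of i.i.d. centered random
vectors, uniformly bounded, with covariance matrices converging to the identity. -/
theorem tendstoInDistribution_stdGaussian_of_bounded_array {E : Type*} [NormedAddCommGroup E]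
    [InnerProductSpace ℝ E] [FiniteDimensional ℝ E] [MeasurableSpace E] [BorelSpace E]
    {Ω : ℕ → Type*} [∀ n, MeasurableSpace (Ω n)]
    (P : ∀ n, Measure (Ω n)) [∀ n, IsProbabilityMeasure (P n)]
    (X : ∀ n, Fin n → Ω n → E) (ν : ℕ → Measure E)
    (hindep : ∀ n, iIndepFun (X n) (P n))
    (hlaw : ∀ (n : ℕ) (i : Fin n), HasLaw (X n i) (ν n) (P n)) (C : ℝ)
    (hb : ∀ n, 0 < n → ∀ᵐ x ∂ν n, ‖x‖ ≤ C)
    (h0 : ∀ n, 0 < n → ∀ t, ∫ x, inner ℝ x t ∂ν n = 0)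
    (hcov : ∀ t, Tendsto (fun n => ∫ x, inner ℝ x t ^ 2 ∂ν n) atTop (𝓝 (‖t‖ ^ 2))) :
    TendstoInDistribution (fun (n : ℕ) ω => (Real.sqrt n)⁻¹ • ∑ i, X n i ω) atTop
      (id : E → E) P (stdGaussian E) where
  forall_aemeasurable n :=
    (Finset.aemeasurable_fun_sum _ fun i _ => (hlaw n i).aemeasurable).const_smul _
  tendsto := by
    refine ProbabilityMeasure.tendsto_iff_tendsto_charFun.2 fun t => ?_
    -- For `n = 0` the row is empty, so nothing is known about `ν 0`.
    have hprob : ∀ n, 0 < n → IsProbabilityMeasure (ν n) := fun n hn => by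
      rw [← (hlaw n ⟨0, hn⟩).map_eq]
      exact Measure.isProbabilityMeasure_map (hlaw n ⟨0, hn⟩).aemeasurable
    have hcf : ∀ n, charFun ((P n).map fun ω => (Real.sqrt n)⁻¹ • ∑ i, X n i ω) t =
        charFun (ν n) ((Real.sqrt n)⁻¹ • t) ^ n := fun n => by
      have hm : AEMeasurable (fun ω => ∑ i, X n i ω) (P n) :=
        Finset.aemeasurable_fun_sum _ fun i _ => (hlaw n i).aemeasurable
      have : ((P n).map fun ω => (Real.sqrt n)⁻¹ • ∑ i, X n i ω) =
          ((P n).map fun ω => ∑ i, X n i ω).map ((Real.sqrt n)⁻¹ • ·) := by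
        rw [AEMeasurable.map_map_of_aemeasurable (by fun_prop) hm]; rfl
      rw [this, charFun_map_smul,
        (hindep n).charFun_map_fun_sum_eq_prod fun i => (hlaw n i).aemeasurable]
      simp [fun i => (hlaw n i).map_eq]
    simp only [ProbabilityMeasure.coe_mk, Measure.map_id, hcf, charFun_stdGaussian]
    set c : ℕ → ℂ := fun n => charFun (ν n) ((Real.sqrt n)⁻¹ • t) - 1 with hc
    have : (fun n => charFun (ν n) ((Real.sqrt n)⁻¹ • t) ^ n) = fun n => (1 + c n) ^ n := by
      ext n; simp [hc]
    rw [this]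
    -- It remains to show that `n * c n` tends to `-‖t‖ ^ 2 / 2`.
    apply Complex.tendsto_one_add_pow_exp_of_tendsto
    have hmain : Tendsto (fun n => ((-(∫ x, inner ℝ x t ^ 2 ∂ν n) / 2 : ℝ) : ℂ)) atTop
        (𝓝 (-‖t‖ ^ 2 / 2)) := by
      have := ((hcov t).neg.div_const 2)
      exact_mod_cast (Complex.continuous_ofReal.tendsto _).comp this
    have hs : Tendsto (fun n : ℕ => (Real.sqrt n)⁻¹) atTop (𝓝 0) :=
      tendsto_inv_atTop_zero.comp (Real.tendsto_sqrt_atTop.comp tendsto_natCast_atTop_atTop)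
    have herr : Tendsto (fun n : ℕ => (Real.sqrt n)⁻¹ * ((C * ‖t‖) ^ 3 *
        Real.exp ((Real.sqrt n)⁻¹ * (C * ‖t‖)))) atTop (𝓝 0) := by
      have h2 : Tendsto (fun n : ℕ => Real.exp ((Real.sqrt n)⁻¹ * (C * ‖t‖))) atTop
          (𝓝 (Real.exp (0 * (C * ‖t‖)))) :=
        (Real.continuous_exp.tendsto _).comp (hs.mul_const _)
      simpa using hs.mul (h2.const_mul ((C * ‖t‖) ^ 3))
    rw [← tendsto_sub_nhds_zero_iff] at hmain ⊢
    have hd : Tendsto (fun n : ℕ => (n : ℂ) * c n -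
        ((-(∫ x, inner ℝ x t ^ 2 ∂ν n) / 2 : ℝ) : ℂ)) atTop (𝓝 0) := by
      refine squeeze_zero_norm' ?_ herr
      filter_upwards [eventually_gt_atTop 0] with n hn
      have := hprob n hn
      have hn' : (0 : ℝ) < n := by exact_mod_cast hn
      have hb' := norm_charFun_smul_sub_le (ν n) (hb n hn) t (h0 n hn t)
        (s := (Real.sqrt n)⁻¹) (by positivity)
      have hsq : (Real.sqrt n)⁻¹ ^ 2 = (n : ℝ)⁻¹ := by
        rw [inv_pow, Real.sq_sqrt hn'.le]
      calc _ = ‖(n : ℂ) * (charFun (ν n) ((Real.sqrt n)⁻¹ • t) -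
            (1 - ((Real.sqrt n)⁻¹ ^ 2 / 2 * ∫ x, inner ℝ x t ^ 2 ∂ν n : ℝ)))‖ := by
            congr 1
            rw [hsq, hc]
            have : (n : ℂ) ≠ 0 := by exact_mod_cast hn.ne'
            push_cast
            field_simp
            ring
        _ ≤ n * (((Real.sqrt n)⁻¹ * (C * ‖t‖)) ^ 3 *
              Real.exp ((Real.sqrt n)⁻¹ * (C * ‖t‖))) := by
            rw [norm_mul, Complex.norm_natCast]
            exact mul_le_mul_of_nonneg_left hb' hn'.le
        _ = (n * (Real.sqrt n)⁻¹ ^ 2) * ((Real.sqrt n)⁻¹ * ((C * ‖t‖) ^ 3 *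
              Real.exp ((Real.sqrt n)⁻¹ * (C * ‖t‖)))) := by ring
        _ = _ := by rw [hsq, mul_inv_cancel₀ hn'.ne', one_mul]
    simpa using hd.add hmain

/-! ### Means over the sphere -/

/-- The mean of a function on `ℝ^d` over the unit sphere `S^{d-1}`. -/
def sphereMean (d : ℕ) (G : EuclideanSpace ℝ (Fin d) → ℝ) : ℝ :=
  ((surfaceMeasure d).real Set.univ)⁻¹ * ∫ u : USphere d, G u.1 ∂surfaceMeasure d

instance isFiniteMeasure_surfaceMeasure (d : ℕ) : IsFiniteMeasure (surfaceMeasure d) := by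
  unfold surfaceMeasure; infer_instance

theorem surfaceMeasure_real_univ_pos {d : ℕ} (hd : 0 < d) :
    0 < (surfaceMeasure d).real Set.univ := by
  have : Nonempty (Fin d) := ⟨⟨0, hd⟩⟩
  have h : surfaceMeasure d ≠ 0 := by
    unfold surfaceMeasure
    exact Measure.toSphere_ne_zero _
  rw [Measure.real, ENNReal.toReal_pos_iff]
  exact ⟨by simpa [pos_iff_ne_zero] using h, measure_lt_top _ _⟩

theorem integrable_exp_neg_norm_sq (E : Type*) [NormedAddCommGroup E] [InnerProductSpace ℝ E]
    [FiniteDimensional ℝ E] [MeasurableSpace E] [BorelSpace E] :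
    Integrable (fun x : E => Real.exp (-‖x‖ ^ 2)) := by
  have := (GaussianFourier.integrable_cexp_neg_mul_sq_norm_add (V := E) (b := 1) (by simp) 0 0).re
  refine this.congr (ae_of_all _ fun x => ?_)
  simp only [neg_mul, one_mul, zero_mul, add_zero]
  rw [← Complex.ofReal_pow, ← Complex.ofReal_neg]
  exact Complex.exp_ofReal_re _

theorem integral_exp_neg_norm_sq_pos (E : Type*) [NormedAddCommGroup E] [InnerProductSpace ℝ E]
    [FiniteDimensional ℝ E] [MeasurableSpace E] [BorelSpace E] :
    0 < ∫ x : E, Real.exp (-‖x‖ ^ 2) := by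
  have := integral_exp_pos (μ := (volume : Measure E)) (integrable_exp_neg_norm_sq E)
  exact this

/-- Polar coordinates: a function of the direction and a function of the norm integrate
independently. -/
theorem integral_mul_norm_eq_toSphere {E : Type*} [NormedAddCommGroup E] [NormedSpace ℝ E]
    [FiniteDimensional ℝ E] [Nontrivial E] [MeasurableSpace E] [BorelSpace E] (μ : Measure E)
    [μ.IsAddHaarMeasure] (G : E → ℝ) (hG : ∀ x ≠ 0, G x = G (‖x‖⁻¹ • x)) (k : ℝ → ℝ) :
    ∫ x, G x * k ‖x‖ ∂μ = (∫ u : Metric.sphere (0 : E) 1, G u.1 ∂μ.toSphere) *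
      ∫ r : Set.Ioi (0 : ℝ), k r ∂.volumeIoiPow (Module.finrank ℝ E - 1) :=
  calc
    ∫ x, G x * k ‖x‖ ∂μ = ∫ x : ({(0)}ᶜ : Set E), G x.1 * k ‖x.1‖ ∂(μ.comap (↑)) := by
      rw [integral_subtype_comap (measurableSet_singleton _).compl fun x ↦ G x * k (‖x‖),
        restrict_compl_singleton]
    _ = ∫ x, G x.1.1 * k x.2 ∂μ.toSphere.prod (.volumeIoiPow (Module.finrank ℝ E - 1)) := by
      rw [← μ.measurePreserving_homeomorphUnitSphereProd.integral_comp
        (Homeomorph.measurableEmbedding _)]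
      refine integral_congr_ae (ae_of_all _ fun x => ?_)
      simp only [homeomorphUnitSphereProd_apply_snd_coe, homeomorphUnitSphereProd_apply_fst_coe]
      rw [← hG _ x.2]
    _ = _ := integral_prod_mul (fun u : Metric.sphere (0 : E) 1 => G u.1)
      fun r : Set.Ioi (0 : ℝ) => k r

/-- Comparison of the polar formula for `G` with the one for the constant `1` removes the radial
integral. No integrability is needed, because the product formula for integrals holds without it. -/
theorem integral_mul_norm_eq_sphereMean {d : ℕ} (hd : 0 < d) (G : EuclideanSpace ℝ (Fin d) → ℝ)
    (hG : ∀ x ≠ 0, G x = G (‖x‖⁻¹ • x)) (k : ℝ → ℝ) :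
    ∫ x, G x * k ‖x‖ = sphereMean d G * ∫ x : EuclideanSpace ℝ (Fin d), k ‖x‖ := by
  have : Nonempty (Fin d) := ⟨⟨0, hd⟩⟩
  have h1 := integral_mul_norm_eq_toSphere
    (volume : Measure (EuclideanSpace ℝ (Fin d))) (fun _ => 1) (fun _ _ => rfl) k
  have hpos := surfaceMeasure_real_univ_pos hd
  simp only [one_mul, integral_const, smul_eq_mul, mul_one] at h1
  rw [integral_mul_norm_eq_toSphere _ G hG, h1, sphereMean]
  change _ = _ * (((surfaceMeasure d).real Set.univ) * _)
  field_simp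
  exact mul_comm _ _

/-- The first `d` coordinates of a vector of `ℝ^{d+1}`. -/
def initPart {d : ℕ} (x : EuclideanSpace ℝ (Fin (d + 1))) : EuclideanSpace ℝ (Fin d) :=
  WithLp.toLp 2 fun i => x i.castSucc

theorem norm_sq_eq_initPart {d : ℕ} (x : EuclideanSpace ℝ (Fin (d + 1))) :
    ‖x‖ ^ 2 = ‖initPart x‖ ^ 2 + x (Fin.last d) ^ 2 := by
  simp [EuclideanSpace.norm_sq_eq, Fin.sum_univ_castSucc, initPart]

theorem measurePreserving_last_initPart (d : ℕ) :
    MeasurePreserving (fun x : EuclideanSpace ℝ (Fin (d + 1)) => (x (Fin.last d), initPart x))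
      volume (volume.prod volume) := by
  have h1 := PiLp.volume_preserving_ofLp (Fin (d + 1))
  have h2 := volume_preserving_piFinSuccAbove (fun _ : Fin (d + 1) => ℝ) (Fin.last d)
  have h3 := (MeasurePreserving.id (volume : Measure ℝ)).prod (PiLp.volume_preserving_toLp (Fin d))
  have h := h3.comp (h2.comp h1)
  convert! h using 1
  ext x : 1
  refine Prod.ext rfl ?_
  ext i
  simp [initPart, Fin.init]

theorem measurableEmbedding_last_initPart (d : ℕ) :
    MeasurableEmbedding (fun x : EuclideanSpace ℝ (Fin (d + 1)) =>
      (x (Fin.last d), initPart x)) := by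
  refine (measurePreserving_last_initPart d).measurable.measurableEmbedding fun x y h => ?_
  simp only [Prod.mk.injEq] at h
  ext i
  refine Fin.lastCases h.1 (fun j => ?_) i
  exact congrFun (congrArg WithLp.ofLp h.2) j

theorem integral_last_initPart {d : ℕ} (g : ℝ × EuclideanSpace ℝ (Fin d) → ℝ) :
    ∫ x : EuclideanSpace ℝ (Fin (d + 1)), g (x (Fin.last d), initPart x) =
      ∫ z, g z ∂(volume.prod volume) :=
  (measurePreserving_last_initPart d).integral_comp (measurableEmbedding_last_initPart d) g

/-- The last coordinate is used in the form `x (Fin.last d) / ‖x‖`, which agrees with it on the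
sphere but depends only on the direction, as polar coordinates require. -/
theorem smul_ratio_invariant {d : ℕ} (h : ℝ → ℝ) (x : EuclideanSpace ℝ (Fin (d + 1))) (hx : x ≠ 0) :
    h (x (Fin.last d) / ‖x‖) = h ((‖x‖⁻¹ • x) (Fin.last d) / ‖‖x‖⁻¹ • x‖) := by
  have : ‖x‖ ≠ 0 := norm_ne_zero_iff.2 hx
  rw [norm_smul, norm_inv, norm_norm, inv_mul_cancel₀ this]
  simp [div_eq_inv_mul]

theorem abs_last_div_norm_le {d : ℕ} (x : EuclideanSpace ℝ (Fin (d + 1))) :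
    |x (Fin.last d) / ‖x‖| ≤ 1 := by
  rw [abs_div, abs_norm]
  exact div_le_one_of_le₀ (by simpa using PiLp.norm_apply_le x (Fin.last d)) (norm_nonneg _)

/-- The direction of the first `d` coordinates is independent of the last coordinate of a uniformly
distributed point of the sphere of `ℝ^{d+1}`. -/
theorem sphereMean_initPart_mul {d : ℕ} (hd : 0 < d) (G : EuclideanSpace ℝ (Fin d) → ℝ)
    (hGm : Measurable G) {C : ℝ} (hGb : ∀ x, |G x| ≤ C)
    (hG : ∀ x ≠ 0, G x = G (‖x‖⁻¹ • x)) (h : ℝ → ℝ) (hh : Measurable h) {D : ℝ}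
    (hhb : ∀ t, |t| ≤ 1 → |h t| ≤ D) :
    sphereMean (d + 1) (fun x => G (initPart x) * h (x (Fin.last d) / ‖x‖)) =
      sphereMean d G * sphereMean (d + 1) (fun x => h (x (Fin.last d) / ‖x‖)) := by
  -- Under the Gaussian weight, Fubini leaves an inner integral depending on the first `d`
  -- coordinates only through their norm, so `G` separates as a mean over the smaller sphere. The
  -- remaining factor does not involve `G`, and the case `G = 1` identifies it.
  have key : ∀ (G : EuclideanSpace ℝ (Fin d) → ℝ) (C : ℝ), Measurable G → (∀ x, |G x| ≤ C) →
      (∀ x ≠ 0, G x = G (‖x‖⁻¹ • x)) →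
      sphereMean (d + 1) (fun x => G (initPart x) * h (x (Fin.last d) / ‖x‖)) *
        ∫ x : EuclideanSpace ℝ (Fin (d + 1)), Real.exp (-‖x‖ ^ 2) =
      sphereMean d G * ∫ x : EuclideanSpace ℝ (Fin d), Real.exp (-‖x‖ ^ 2) *
        ∫ s, h (s / Real.sqrt (‖x‖ ^ 2 + s ^ 2)) * Real.exp (-s ^ 2) := by
    intro G C hGm hGb hG
    have hinit : Measurable (initPart : EuclideanSpace ℝ (Fin (d + 1)) → _) :=
      (measurePreserving_last_initPart d).measurable.snd
    rw [← integral_mul_norm_eq_sphereMean d.succ_pos _ _ fun r => Real.exp (-r ^ 2),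
      ← integral_mul_norm_eq_sphereMean hd G hG fun r => Real.exp (-r ^ 2) *
        ∫ s, h (s / Real.sqrt (r ^ 2 + s ^ 2)) * Real.exp (-s ^ 2)]
    · set g : ℝ × EuclideanSpace ℝ (Fin d) → ℝ := fun z =>
        G z.2 * h (z.1 / Real.sqrt (‖z.2‖ ^ 2 + z.1 ^ 2)) * Real.exp (-(‖z.2‖ ^ 2 + z.1 ^ 2))
        with hgdef
      have hg : ∀ x : EuclideanSpace ℝ (Fin (d + 1)),
          G (initPart x) * h (x (Fin.last d) / ‖x‖) * Real.exp (-‖x‖ ^ 2) =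
          g (x (Fin.last d), initPart x) := fun x => by
        simp only [hgdef]
        rw [← norm_sq_eq_initPart, Real.sqrt_sq (norm_nonneg _)]
      have hint : Integrable g (volume.prod volume) := by
        rw [← (measurePreserving_last_initPart d).integrable_comp_emb
          (measurableEmbedding_last_initPart d)]
        have : (g ∘ fun x : EuclideanSpace ℝ (Fin (d + 1)) => (x (Fin.last d), initPart x)) =
            fun x => G (initPart x) * h (x (Fin.last d) / ‖x‖) * Real.exp (-‖x‖ ^ 2) :=
          funext fun x => (hg x).symm
        rw [this]
        refine (integrable_exp_neg_norm_sq _).bdd_mul (c := C * D) ?_ (ae_of_all _ fun x => ?_)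
        · exact ((hGm.comp hinit).mul (hh.comp (by fun_prop))).aestronglyMeasurable
        · rw [Real.norm_eq_abs, abs_mul]
          exact mul_le_mul (hGb _) (hhb _ (abs_last_div_norm_le x)) (abs_nonneg _)
            ((abs_nonneg _).trans (hGb 0))
      simp_rw [hg]
      rw [integral_last_initPart, integral_prod_symm _ hint]
      refine integral_congr_ae (ae_of_all _ fun y => ?_)
      simp only [hgdef, ← integral_const_mul]
      refine integral_congr_ae (ae_of_all _ fun s => ?_)
      simp only [neg_add, Real.exp_add]
      ring
    · intro x hx
      rw [← smul_ratio_invariant h x hx]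
      congr 1
      have hs : initPart (‖x‖⁻¹ • x) = ‖x‖⁻¹ • initPart x := by
        ext i; simp [initPart]
      rw [hs]
      have hx' : 0 < ‖x‖ := norm_pos_iff.2 hx
      -- At the poles the first coordinates have no direction, but scaling leaves the zero vector
      -- unchanged.
      by_cases h0 : initPart x = 0
      · simp [h0]
      · rw [hG _ h0, hG (‖x‖⁻¹ • initPart x) (smul_ne_zero (inv_ne_zero hx'.ne') h0), norm_smul,
          norm_inv, norm_norm, smul_smul]
        congr 2
        field_simp
  have hZ := integral_exp_neg_norm_sq_pos (EuclideanSpace ℝ (Fin (d + 1)))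
  have h1 := key G C hGm hGb hG
  have h2 := key (fun _ => 1) 1 measurable_const (by simp) (fun _ _ => rfl)
  have h3 : sphereMean d (fun _ => 1) = 1 := by
    have := surfaceMeasure_real_univ_pos hd
    simp [sphereMean, this.ne']
  simp only [one_mul, h3] at h2
  rw [← h2] at h1
  exact mul_right_cancel₀ hZ.ne' (by rw [h1]; ring)

/-! ### Gaussian moments and the moments of one coordinate on the sphere -/

theorem integral_pow_add_two_mul_exp_neg_sq (k : ℕ) :
    ∫ s : ℝ, s ^ (k + 2) * Real.exp (-s ^ 2) =
      (k + 1) / 2 * ∫ s : ℝ, s ^ k * Real.exp (-s ^ 2) := by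
  rcases Nat.even_or_odd k with hk | hk
  · have h : ∀ j : ℕ, Even j → ∫ s : ℝ, s ^ j * Real.exp (-s ^ 2) =
        Real.Gamma ((j + 1) / 2) := fun j hj => by
      have h1 := integral_comp_abs (f := fun s : ℝ => s ^ j * Real.exp (-s ^ 2))
      simp only [sq_abs, hj.pow_abs] at h1
      have h2 := integral_rpow_mul_exp_neg_rpow (p := 2) (q := j) two_pos
        (by have : (0 : ℝ) ≤ j := j.cast_nonneg
            linarith)
      simp only [Real.rpow_natCast, Real.rpow_two] at h2
      rw [h1, h2]; ring
    rw [h k hk, h (k + 2) (hk.add even_two)]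
    have : ((k + 2 : ℕ) + 1 : ℝ) / 2 = (k + 1) / 2 + 1 := by push_cast; ring
    rw [this, Real.Gamma_add_one (by positivity)]
  · have h : ∀ j : ℕ, Odd j → ∫ s : ℝ, s ^ j * Real.exp (-s ^ 2) = 0 := fun j hj => by
      have := integral_neg_eq_self (fun s : ℝ => s ^ j * Real.exp (-s ^ 2)) volume
      simp only [hj.neg_pow, even_two.neg_pow, neg_mul, integral_neg] at this
      linarith
    rw [h k hk, h (k + 2) (hk.add_even even_two), mul_zero]

theorem integral_norm_pow_mul_exp_neg_norm_sq {d : ℕ} (hd : 0 < d) (k : ℕ) :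
    ∫ x : EuclideanSpace ℝ (Fin d), ‖x‖ ^ k * Real.exp (-‖x‖ ^ 2) =
      d * volume.real (Metric.ball (0 : EuclideanSpace ℝ (Fin d)) 1) *
        (1 / 2 * Real.Gamma ((d + k) / 2)) := by
  have : Nonempty (Fin d) := ⟨⟨0, hd⟩⟩
  have h := integral_fun_norm_addHaar (volume : Measure (EuclideanSpace ℝ (Fin d)))
    (fun r => r ^ k * Real.exp (-r ^ 2))
  rw [h]
  have h2 := integral_rpow_mul_exp_neg_rpow (p := 2) (q := (d - 1 + k : ℕ)) two_pos
        (by have : (0 : ℝ) ≤ (d - 1 + k : ℕ) := Nat.cast_nonneg _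
            linarith)
  simp only [Real.rpow_natCast, Real.rpow_two] at h2
  have h3 : (((d - 1 + k : ℕ) : ℝ) + 1) / 2 = (d + k) / 2 := by
    rw [← Nat.cast_add_one, ← Nat.cast_add]; congr 2; omega
  simp only [finrank_euclideanSpace, Fintype.card_fin, smul_eq_mul, nsmul_eq_mul, ← mul_assoc,
    ← pow_add]
  rw [h2, h3]
  ring

theorem integral_norm_pow_mul_exp_neg_norm_sq_pos {d : ℕ} (hd : 0 < d) (k : ℕ) :
    0 < ∫ x : EuclideanSpace ℝ (Fin d), ‖x‖ ^ k * Real.exp (-‖x‖ ^ 2) := by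
  have : (0 : ℝ) < d := by exact_mod_cast hd
  have hv : 0 < volume.real (Metric.ball (0 : EuclideanSpace ℝ (Fin d)) 1) :=
    ENNReal.toReal_pos (Metric.measure_ball_pos _ _ one_pos).ne' measure_ball_lt_top.ne
  have := Real.Gamma_pos_of_pos (s := (d + k) / 2) (by positivity)
  rw [integral_norm_pow_mul_exp_neg_norm_sq hd]
  positivity

/-- Both sides are the Gaussian integral of the `k`-th power of the last coordinate, once in polar
coordinates and once by splitting off that coordinate. -/
theorem sphereMean_last_pow_mul {d : ℕ} (k : ℕ) :
    sphereMean (d + 1) (fun x => (x (Fin.last d) / ‖x‖) ^ k) *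
        ∫ x : EuclideanSpace ℝ (Fin (d + 1)), ‖x‖ ^ k * Real.exp (-‖x‖ ^ 2) =
      (∫ s : ℝ, s ^ k * Real.exp (-s ^ 2)) *
        ∫ y : EuclideanSpace ℝ (Fin d), Real.exp (-‖y‖ ^ 2) := by
  rw [← integral_mul_norm_eq_sphereMean d.succ_pos _ (fun x hx => smul_ratio_invariant (· ^ k) x hx)
    fun r => r ^ k * Real.exp (-r ^ 2), ← integral_prod_mul,
    ← integral_last_initPart fun z : ℝ × EuclideanSpace ℝ (Fin d) =>
      z.1 ^ k * Real.exp (-z.1 ^ 2) * Real.exp (-‖z.2‖ ^ 2)]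
  refine integral_congr_ae (ae_of_all _ fun x => ?_)
  simp only []
  rcases eq_or_ne x 0 with rfl | hx
  · have h0 : initPart (0 : EuclideanSpace ℝ (Fin (d + 1))) = 0 := rfl
    rcases eq_or_ne k 0 with rfl | hk <;> simp [*]
  · have : ‖x‖ ≠ 0 := norm_ne_zero_iff.2 hx
    rw [← mul_assoc, ← mul_pow, div_mul_cancel₀ _ this, mul_assoc, ← Real.exp_add,
      norm_sq_eq_initPart]
    ring_nf

/-- Raising the power by two multiplies the radial moment by `(d + 1 + k) / 2` and the
one-dimensional one by `(k + 1) / 2`. This recurrence is the source of the Pearson identity below.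
-/
theorem sphereMean_last_pow_add_two {d : ℕ} (k : ℕ) :
    (k + (d + 1)) * sphereMean (d + 1) (fun x => (x (Fin.last d) / ‖x‖) ^ (k + 2)) =
      (k + 1) * sphereMean (d + 1) (fun x => (x (Fin.last d) / ‖x‖) ^ k) := by
  have h1 := sphereMean_last_pow_mul (d := d) k
  have h2 := sphereMean_last_pow_mul (d := d) (k + 2)
  have hp := integral_norm_pow_mul_exp_neg_norm_sq_pos d.succ_pos k
  have hr : ∫ x : EuclideanSpace ℝ (Fin (d + 1)), ‖x‖ ^ (k + 2) * Real.exp (-‖x‖ ^ 2) =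
      (d + 1 + k) / 2 * ∫ x : EuclideanSpace ℝ (Fin (d + 1)), ‖x‖ ^ k * Real.exp (-‖x‖ ^ 2) := by
    rw [integral_norm_pow_mul_exp_neg_norm_sq d.succ_pos,
      integral_norm_pow_mul_exp_neg_norm_sq d.succ_pos]
    have : ((d + 1 : ℕ) + (k + 2 : ℕ) : ℝ) / 2 = ((d + 1 : ℕ) + k) / 2 + 1 := by push_cast; ring
    rw [this, Real.Gamma_add_one (by positivity)]
    push_cast
    ring
  rw [integral_pow_add_two_mul_exp_neg_sq, hr, mul_assoc, ← h1] at h2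
  exact mul_right_cancel₀ hp.ne' (by linarith)

theorem sphereMean_last_pow_one {d : ℕ} :
    sphereMean (d + 1) (fun x => (x (Fin.last d) / ‖x‖) ^ 1) = 0 := by
  have h1 := sphereMean_last_pow_mul (d := d) 1
  have hp := integral_norm_pow_mul_exp_neg_norm_sq_pos d.succ_pos 1
  have h0 : ∫ s : ℝ, s ^ 1 * Real.exp (-s ^ 2) = 0 := by
    have := integral_neg_eq_self (fun s : ℝ => s ^ 1 * Real.exp (-s ^ 2)) volume
    simp only [pow_one, even_two.neg_pow, neg_mul, integral_neg] at this
    simp only [pow_one]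
    linarith
  rw [h0, zero_mul] at h1
  exact (mul_eq_zero.1 h1).resolve_right hp.ne'

/-- The mean over the circle of a function of the angle. -/
theorem sphereMean_azimuth (z : ℝ → ℝ) :
    sphereMean 2 (fun x => z (azimuth le_rfl x)) =
      (2 * Real.pi)⁻¹ * ∫ s in Set.Ioo (-Real.pi) Real.pi, z s := by
  -- Polar coordinates in `ℂ` after identifying a point with `x₂ + i x₁`, whose argument is the
  -- azimuth; hence the swap of coordinates. Taking `z = 1` then eliminates the radial integral.
  have key : ∀ z : ℝ → ℝ, sphereMean 2 (fun x => z (azimuth le_rfl x)) *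
      ∫ x : EuclideanSpace ℝ (Fin 2), Real.exp (-‖x‖ ^ 2) =
      (∫ r in Set.Ioi (0 : ℝ), r * Real.exp (-r ^ 2)) *
        ∫ s in Set.Ioo (-Real.pi) Real.pi, z s := fun z => by
    rw [← integral_mul_norm_eq_sphereMean two_pos _ _ fun r => Real.exp (-r ^ 2)]
    · have e1 : ∀ x : EuclideanSpace ℝ (Fin 2),
          z (azimuth le_rfl x) * Real.exp (-‖x‖ ^ 2) =
          (fun w : ℂ => z (Complex.arg w) * Real.exp (-‖w‖ ^ 2)) ⟨x 1, x 0⟩ := fun x => by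
        have : ‖(⟨x 1, x 0⟩ : ℂ)‖ ^ 2 = ‖x‖ ^ 2 := by
          rw [Complex.sq_norm, Complex.normSq_mk, EuclideanSpace.norm_sq_eq, Fin.sum_univ_two]
          simp; ring
        simp only [this, azimuth]
        rfl
      simp_rw [e1]
      have hmp : MeasurePreserving (fun x : EuclideanSpace ℝ (Fin 2) => (⟨x 1, x 0⟩ : ℂ)) := by
        have h1 := PiLp.volume_preserving_ofLp (Fin 2)
        have h2 := (volume_preserving_finTwoArrow ℝ).comp h1
        have h3 : MeasurePreserving (Prod.swap : ℝ × ℝ → ℝ × ℝ) :=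
          Measure.measurePreserving_swap
        exact Complex.volume_preserving_equiv_real_prod.symm.comp (h3.comp h2)
      have hme : MeasurableEmbedding (fun x : EuclideanSpace ℝ (Fin 2) => (⟨x 1, x 0⟩ : ℂ)) := by
        refine hmp.measurable.measurableEmbedding fun x y h => ?_
        simp only [Complex.mk.injEq] at h
        ext i
        fin_cases i
        exacts [h.2, h.1]
      rw [hmp.integral_comp hme fun w : ℂ => z (Complex.arg w) * Real.exp (-‖w‖ ^ 2),
        ← Complex.integral_comp_polarCoord_symm, polarCoord_target,
        ← setIntegral_prod_mul]
      refine setIntegral_congr_fun (measurableSet_Ioi.prod measurableSet_Ioo) fun q hq => ?_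
      obtain ⟨hq1, hq2⟩ := hq
      simp only [Complex.polarCoord_symm_apply, smul_eq_mul, Complex.ofReal_cos,
        Complex.ofReal_sin]
      rw [Complex.arg_mul_cos_add_sin_mul_I hq1 ⟨hq2.1, hq2.2.le⟩]
      have : ‖(q.1 : ℂ) * (Complex.cos q.2 + Complex.sin q.2 * Complex.I)‖ = q.1 := by
        rw [norm_mul, Complex.norm_real, Real.norm_of_nonneg (le_of_lt hq1),
          Complex.norm_cos_add_sin_mul_I, mul_one]
      rw [this]
      ring
    · intro x hx
      congr 1
      have : 0 < ‖x‖ := norm_pos_iff.2 hx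
      rw [azimuth, azimuth, ← Complex.arg_real_mul _ (inv_pos.2 this)]
      congr 1
      apply Complex.ext <;> simp
  have h1 := key z
  have h2 := key fun _ => 1
  have hZ := integral_exp_neg_norm_sq_pos (EuclideanSpace ℝ (Fin 2))
  have h3 : sphereMean 2 (fun _ => 1) = 1 := by
    have := surfaceMeasure_real_univ_pos two_pos
    simp [sphereMean, this.ne']
  rw [h3] at h2
  have h4 : ∫ s in Set.Ioo (-Real.pi) Real.pi, (1 : ℝ) = 2 * Real.pi := by
    have := Real.pi_pos
    simp [Measure.real, Real.volume_Ioo]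
    rw [ENNReal.toReal_ofReal (by linarith)]
    ring
  rw [h4, one_mul] at h2
  rw [h2] at h1
  have hR : (∫ r in Set.Ioi (0 : ℝ), r * Real.exp (-r ^ 2)) ≠ 0 := by
    intro h
    rw [h, zero_mul] at h2
    exact hZ.ne' h2
  have := Real.pi_pos
  field_simp
  exact mul_left_cancel₀ hR (by linarith)

/-! ### Gegenbauer polynomials -/

open Polynomial in
/-- The Gegenbauer polynomial `C_q^λ` as an element of `ℝ[X]`. -/
def gegPoly (lam : ℝ) (q : ℕ) : ℝ[X] :=
  ∑ j ∈ Finset.range (q / 2 + 1),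
    C ((-1) ^ j * (2 ^ (q - 2 * j) * Real.Gamma ((q : ℝ) - j + lam) /
        (Real.Gamma lam * (j.factorial : ℝ) * ((q - 2 * j).factorial : ℝ)))) * X ^ (q - 2 * j)

theorem eval_gegPoly (lam : ℝ) (q : ℕ) (t : ℝ) :
    (gegPoly lam q).eval t = gegenbauer lam q t := by
  simp [gegPoly, gegenbauer, Polynomial.eval_finsetSum]

theorem pochhammerSymbol_succ (a : ℝ) (k : ℕ) :
    pochhammerSymbol a (k + 1) = pochhammerSymbol a k * (a + k) := by
  simp [pochhammerSymbol, Finset.prod_range_succ]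

theorem pochhammerSymbol_zero (a : ℝ) : pochhammerSymbol a 0 = 1 := by simp [pochhammerSymbol]

theorem pochhammerSymbol_pos {a : ℝ} (ha : 0 < a) (k : ℕ) : 0 < pochhammerSymbol a k :=
  Finset.prod_pos fun _ _ => by positivity

theorem Gamma_add_natCast {a : ℝ} (ha : 0 < a) (k : ℕ) :
    Real.Gamma (k + a) = pochhammerSymbol a k * Real.Gamma a := by
  induction k with
  | zero => simp [pochhammerSymbol_zero]
  | succ k ih =>
    rw [pochhammerSymbol_succ, show ((k + 1 : ℕ) : ℝ) + a = (k + a) + 1 by push_cast; ring,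
      Real.Gamma_add_one (by positivity), ih]
    ring

/-- The coefficient of `X^k` in `C_{k+2j}^λ`. -/
def gegCoeff (lam : ℝ) (k j : ℕ) : ℝ :=
  (-1) ^ j * (2 ^ k * pochhammerSymbol lam (k + j) / ((j.factorial : ℝ) * (k.factorial : ℝ)))

/-- Writing the degree as `k + 2 * j` isolates the single contributing summand and removes the
truncated subtractions. -/
theorem coeff_gegPoly_add {lam : ℝ} (hl : 0 < lam) (k j : ℕ) :
    (gegPoly lam (k + 2 * j)).coeff k = gegCoeff lam k j := by
  have hG := (Real.Gamma_pos_of_pos hl).ne'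
  simp only [gegPoly, Polynomial.finsetSum_coeff, Polynomial.coeff_C_mul_X_pow]
  rw [Finset.sum_eq_single j]
  · rw [if_pos (by omega), Nat.add_sub_cancel, gegCoeff]
    have : ((k + 2 * j : ℕ) : ℝ) - j + lam = ((k + j : ℕ) : ℝ) + lam := by push_cast; ring
    rw [this, Gamma_add_natCast hl]
    field_simp
  · intro i hi hij
    rw [Finset.mem_range] at hi
    exact if_neg (by omega)
  · intro h
    rw [Finset.mem_range] at h
    omega

theorem coeff_gegPoly_eq_zero (lam : ℝ) {n k : ℕ} (h : ∀ j, n ≠ k + 2 * j) :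
    (gegPoly lam n).coeff k = 0 := by
  simp only [gegPoly, Polynomial.finsetSum_coeff, Polynomial.coeff_C_mul_X_pow]
  refine Finset.sum_eq_zero fun i hi => if_neg fun hk => ?_
  rw [Finset.mem_range] at hi
  exact h i (by omega)

theorem gegPoly_zero {lam : ℝ} (hl : 0 < lam) : gegPoly lam 0 = 1 := by
  simp [gegPoly, (Real.Gamma_pos_of_pos hl).ne']

theorem gegPoly_one {lam : ℝ} (hl : 0 < lam) :
    gegPoly lam 1 = Polynomial.C (2 * lam) * Polynomial.X := by
  have hG := (Real.Gamma_pos_of_pos hl).ne'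
  have h : 2 * (lam * Real.Gamma lam) / Real.Gamma lam = 2 * lam := by field_simp
  simp [gegPoly, add_comm (1 : ℝ), Real.Gamma_add_one hl.ne', h]

open Polynomial in
theorem coeff_X_mul_derivative (p : ℝ[X]) (k : ℕ) :
    (X * derivative p).coeff k = k * p.coeff k := by
  cases k with
  | zero => simp
  | succ k => rw [coeff_X_mul, coeff_derivative]; push_cast; ring

/-- Relates two consecutive nonzero coefficients of the same polynomial, of degree `k + 2 * j + 2`;
this is the differential equation read at `X ^ k`. -/
theorem mul_gegCoeff_add_two (lam : ℝ) (k j : ℕ) :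
    ((k : ℝ) + 1) * (k + 2) * gegCoeff lam (k + 2) j =
      -(4 * (j + 1) * (k + j + 1 + lam)) * gegCoeff lam k (j + 1) := by
  simp only [gegCoeff, show k + 2 + j = k + (j + 1) + 1 by ring, pochhammerSymbol_succ lam,
    Nat.factorial_succ]
  have h1 : (k.factorial : ℝ) ≠ 0 := by positivity
  have h2 : (j.factorial : ℝ) ≠ 0 := by positivity
  push_cast
  field_simp
  ring

open Polynomial in
/-- The Gegenbauer differential equation. -/
theorem gegPoly_differential_equation {lam : ℝ} (hl : 0 < lam) (n : ℕ) :
    (1 - X ^ 2) * derivative (derivative (gegPoly lam n)) -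
        C (2 * lam + 1) * (X * derivative (gegPoly lam n)) =
      - C (n * (n + 2 * lam)) * gegPoly lam n := by
  -- The equation solved for the bare second derivative. The operator `q ↦ X * q'` acts diagonally
  -- on monomials, so only the left side shifts the coefficient index.
  have key : derivative (derivative (gegPoly lam n)) =
      X * derivative (X * derivative (gegPoly lam n)) +
        C (2 * lam) * (X * derivative (gegPoly lam n)) - C (n * (n + 2 * lam)) * gegPoly lam n := by
    ext k
    simp only [coeff_sub, coeff_add, coeff_C_mul, coeff_X_mul_derivative, coeff_derivative]
    by_cases h : ∃ j, n = k + 2 * j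
    · obtain ⟨j, rfl⟩ := h
      rw [coeff_gegPoly_add hl]
      cases j with
      | zero =>
        rw [coeff_gegPoly_eq_zero _ (by omega)]
        push_cast; ring
      | succ j =>
        rw [show k + 2 * (j + 1) = k + 1 + 1 + 2 * j by ring, coeff_gegPoly_add hl]
        have := mul_gegCoeff_add_two lam k j
        push_cast
        rw [show k + 1 + 1 = k + 2 from rfl]
        linarith
    · push Not at h
      rw [coeff_gegPoly_eq_zero _ h, coeff_gegPoly_eq_zero _ fun j hj => h (j + 1) (by omega)]
      ring
  simp only [derivative_mul, derivative_X, one_mul, map_add, map_mul, C_1] at key ⊢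
  linear_combination key

open Polynomial in
-- Comparison of coefficients. The boundary cases are the constant term, to which the product with
-- `X` contributes nothing, and the leading term, to which the polynomial of degree `n` contributes
-- nothing.
theorem gegPoly_recurrence {lam : ℝ} (hl : 0 < lam) (n : ℕ) :
    C ((n : ℝ) + 2) * gegPoly lam (n + 2) =
      C (2 * (n + 1 + lam)) * (X * gegPoly lam (n + 1)) - C (n + 2 * lam) * gegPoly lam n := by
  ext k
  simp only [coeff_sub, coeff_C_mul]
  by_cases h : ∃ j, n + 2 = k + 2 * j
  · obtain ⟨j, hj⟩ := h
    have hn : (n : ℝ) = k + 2 * j - 2 := by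
      have : ((n + 2 : ℕ) : ℝ) = (k + 2 * j : ℕ) := by rw [hj]
      push_cast at this; linarith
    have e1 : (gegPoly lam (n + 2)).coeff k = gegCoeff lam k j := by
      rw [hj, coeff_gegPoly_add hl]
    have h2 : (k.factorial : ℝ) ≠ 0 := by positivity
    rw [e1]
    cases k with
    | zero =>
      obtain ⟨j, rfl⟩ : ∃ i, j = i + 1 := ⟨j - 1, by omega⟩
      obtain rfl : n = 0 + 2 * j := by omega
      rw [coeff_gegPoly_add hl, coeff_X_mul_zero]
      have h1 : (j.factorial : ℝ) ≠ 0 := by positivity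
      simp only [gegCoeff, Nat.factorial_succ, ← add_assoc, pochhammerSymbol_succ lam]
      push_cast
      field_simp
      ring
    | succ k =>
      have h3 : (k.factorial : ℝ) ≠ 0 := by positivity
      rw [coeff_X_mul, show n + 1 = k + 2 * j by omega, coeff_gegPoly_add hl]
      cases j with
      | zero =>
        rw [coeff_gegPoly_eq_zero _ (by omega), hn]
        simp only [gegCoeff, Nat.factorial_succ, add_zero, pochhammerSymbol_succ lam]
        push_cast
        field_simp
        ring
      | succ j =>
        have h1 : (j.factorial : ℝ) ≠ 0 := by positivity
        have e2 : (gegPoly lam n).coeff (k + 1) = gegCoeff lam (k + 1) j := by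
          rw [show n = k + 1 + 2 * j by omega, coeff_gegPoly_add hl]
        rw [e2, hn]
        simp only [gegCoeff, Nat.factorial_succ, show k + 1 + (j + 1) = k + j + 1 + 1 by ring,
          show k + (j + 1) = k + j + 1 by ring, show k + 1 + j = k + j + 1 by ring,
          pochhammerSymbol_succ lam]
        push_cast
        field_simp
        ring
  · push Not at h
    rw [coeff_gegPoly_eq_zero _ h, coeff_gegPoly_eq_zero (n := n) _ fun j hj => h (j + 1) (by omega)]
    cases k with
    | zero => simp
    | succ k =>
      rw [coeff_X_mul, coeff_gegPoly_eq_zero _ fun j hj => h j (by omega)]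
      ring

/-! ### Orthogonality and norms from the Pearson identity -/

section PearsonFunctional

open Polynomial

variable {lam : ℝ} {L : ℝ[X] →ₗ[ℝ] ℝ}

/-- The hypothesis `hL` is integration by parts against the weight `(1 - t ^ 2) ^ (lam - 1 / 2)`,
stated for an abstract functional. It makes the Gegenbauer operator symmetric, and the eigenvalues
`n * (n + 2 * lam)` are distinct. -/
theorem functional_gegPoly_eq_zero (hl : 0 < lam)
    (hL : ∀ q, L ((1 - X ^ 2) * derivative q) = (2 * lam + 1) * L (X * q))
    {n m : ℕ} (hnm : n ≠ m) : L (gegPoly lam n * gegPoly lam m) = 0 := by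
  have hC : ∀ (a : ℝ) (q : ℝ[X]), L (C a * q) = a * L q := fun a q => by
    rw [← smul_eq_C_mul, map_smul, smul_eq_mul]
  have key : ∀ (n : ℕ) (r : ℝ[X]),
      L ((1 - X ^ 2) * (derivative (gegPoly lam n) * derivative r)) =
        n * (n + 2 * lam) * L (gegPoly lam n * r) := fun n r => by
    have h1 := hL (derivative (gegPoly lam n) * r)
    have h2 : (1 - X ^ 2) * derivative (derivative (gegPoly lam n) * r) =
        C (2 * lam + 1) * (X * (derivative (gegPoly lam n) * r)) -
          C (n * (n + 2 * lam)) * (gegPoly lam n * r) +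
          (1 - X ^ 2) * (derivative (gegPoly lam n) * derivative r) := by
      rw [derivative_mul]
      linear_combination r * gegPoly_differential_equation hl n
    rw [h2, map_add, map_sub, hC, hC] at h1
    linarith
  have h1 := key n (gegPoly lam m)
  have h2 := key m (gegPoly lam n)
  rw [mul_comm (derivative (gegPoly lam n)), h2, mul_comm (gegPoly lam m)] at h1
  have h3 : ((n : ℝ) - m) * ((n + m + 2 * lam) * L (gegPoly lam n * gegPoly lam m)) = 0 := by
    linarith
  have h4 : (n : ℝ) - m ≠ 0 := sub_ne_zero.2 (by exact_mod_cast hnm)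
  have h5 : (n : ℝ) + m + 2 * lam ≠ 0 := by positivity
  exact ((mul_eq_zero.1 ((mul_eq_zero.1 h3).resolve_left h4)).resolve_left h5)

/-- Pairing the three-term recurrence with its lowest and with its highest member expresses both
square norms through the same mixed quantity `L (X * C_{n+1} * C_n)`. -/
theorem functional_gegPoly_sq_succ (hl : 0 < lam)
    (hL : ∀ q, L ((1 - X ^ 2) * derivative q) = (2 * lam + 1) * L (X * q)) (n : ℕ) :
    (n + 1) * (n + 1 + lam) * L (gegPoly lam (n + 1) * gegPoly lam (n + 1)) =
      (n + lam) * (n + 2 * lam) * L (gegPoly lam n * gegPoly lam n) := by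
  have hC : ∀ (a : ℝ) (q : ℝ[X]), L (C a * q) = a * L q := fun a q => by
    rw [← smul_eq_C_mul, map_smul, smul_eq_mul]
  have up : 2 * (n + 1 + lam) * L (X * (gegPoly lam (n + 1) * gegPoly lam n)) =
      (n + 2 * lam) * L (gegPoly lam n * gegPoly lam n) := by
    have h := congrArg (fun q => L (q * gegPoly lam n)) (gegPoly_recurrence hl n)
    simp only [sub_mul, map_sub, mul_assoc] at h
    simp only [hC, functional_gegPoly_eq_zero hl hL (show n + 2 ≠ n by omega)] at h
    linarith
  have down : ((n : ℝ) + 1) * L (gegPoly lam (n + 1) * gegPoly lam (n + 1)) =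
      2 * (n + lam) * L (X * (gegPoly lam (n + 1) * gegPoly lam n)) := by
    cases n with
    -- The recurrence starts at degree two, so the first step uses `C_1 = 2 * lam * X` directly.
    | zero =>
      have : gegPoly lam (0 + 1) * gegPoly lam (0 + 1) =
          C (2 * lam) * (X * (gegPoly lam (0 + 1) * gegPoly lam 0)) := by
        rw [zero_add, gegPoly_zero hl, gegPoly_one hl]; ring
      rw [this, hC]
      push_cast; ring
    | succ n =>
      have h := congrArg (fun q => L (q * gegPoly lam (n + 2))) (gegPoly_recurrence hl n)
      simp only [sub_mul, map_sub, mul_assoc] at h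
      simp only [hC, functional_gegPoly_eq_zero hl hL (show n ≠ n + 2 by omega)] at h
      rw [mul_comm (gegPoly lam (n + 1)) (gegPoly lam (n + 2))] at h
      push_cast
      rw [show n + 1 + 1 = n + 2 from rfl]
      linarith
  linear_combination (n + 1 + lam) * down + (n + lam) * up

theorem functional_gegPoly_sq (hl : 0 < lam)
    (hL : ∀ q, L ((1 - X ^ 2) * derivative q) = (2 * lam + 1) * L (X * q)) (n : ℕ) :
    L (gegPoly lam n * gegPoly lam n) =
      pochhammerSymbol (2 * lam) n * lam / (n.factorial * (n + lam)) * L 1 := by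
  induction n with
  | zero => simp [gegPoly_zero hl, pochhammerSymbol_zero, hl.ne']
  | succ n ih =>
    have h := functional_gegPoly_sq_succ hl hL n
    have h1 : ((n : ℝ) + 1) * (n + 1 + lam) ≠ 0 := by positivity
    rw [ih] at h
    refine mul_left_cancel₀ h1 (h.trans ?_)
    rw [pochhammerSymbol_succ, Nat.factorial_succ]
    have : (n.factorial : ℝ) ≠ 0 := by positivity
    push_cast
    field_simp
    ring

end PearsonFunctional

/-! ### The distribution of the last coordinate -/

section LastCoordinate

open Polynomial

theorem integrable_surfaceMeasure_of_bounded {d : ℕ} {G : USphere d → ℝ} (hG : Measurable G)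
    {C : ℝ} (hC : ∀ x, |G x| ≤ C) : Integrable G (surfaceMeasure d) :=
  Integrable.of_bound hG.aestronglyMeasurable C (ae_of_all _ hC)

theorem exists_abs_le_of_continuous {g : ℝ → ℝ} (hg : Continuous g) :
    ∃ C, ∀ t : ℝ, |t| ≤ 1 → |g t| ≤ C := by
  obtain ⟨C, hC⟩ := (isCompact_Icc (a := (-1 : ℝ)) (b := 1)).exists_bound_of_continuousOn
    (f := g) hg.continuousOn
  exact ⟨C, fun t ht => hC t (abs_le.1 ht)⟩

theorem integrable_eval_last {d : ℕ} (q : ℝ[X]) :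
    Integrable (fun u : USphere (d + 1) => q.eval (u.1 (Fin.last d) / ‖u.1‖))
      (surfaceMeasure (d + 1)) := by
  obtain ⟨C, hC⟩ := exists_abs_le_of_continuous q.continuous
  exact integrable_surfaceMeasure_of_bounded (q.continuous.measurable.comp (by fun_prop))
    fun u => hC _ (abs_last_div_norm_le u.1)

/-- The expectation of `q(x_{d+1})` for a uniformly distributed point `x` of the sphere of
`ℝ^{d+1}`. -/
def lastFunctional (d : ℕ) : ℝ[X] →ₗ[ℝ] ℝ where
  toFun q := sphereMean (d + 1) fun x => q.eval (x (Fin.last d) / ‖x‖)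
  map_add' p q := by
    simp only [sphereMean, eval_add]
    rw [integral_add (integrable_eval_last p) (integrable_eval_last q), mul_add]
  map_smul' a q := by
    simp only [sphereMean, eval_smul, smul_eq_mul, RingHom.id_apply]
    rw [integral_const_mul]; ring

theorem lastFunctional_apply (d : ℕ) (q : ℝ[X]) :
    lastFunctional d q = sphereMean (d + 1) fun x => q.eval (x (Fin.last d) / ‖x‖) := rfl

theorem lastFunctional_one (d : ℕ) : lastFunctional d 1 = 1 := by
  have := surfaceMeasure_real_univ_pos d.succ_pos
  simp [lastFunctional_apply, sphereMean, this.ne']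

/-- By linearity it suffices to treat monomials, where this is the moment recurrence, or the
vanishing of the first moment when `q` is constant. No density is needed. -/
theorem lastFunctional_pearson (d : ℕ) (q : ℝ[X]) :
    lastFunctional d ((1 - X ^ 2) * derivative q) = d * lastFunctional d (X * q) := by
  induction q using Polynomial.induction_on' with
  | add p q hp hq => simp only [mul_add, map_add, hp, hq]
  | monomial k a =>
    rw [← C_mul_X_pow_eq_monomial, derivative_C_mul, derivative_X_pow]
    have hX : ∀ j, lastFunctional d (X ^ j) =
        sphereMean (d + 1) (fun x => (x (Fin.last d) / ‖x‖) ^ j) := fun j => by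
      simp [lastFunctional_apply]
    cases k with
    | zero =>
      have : lastFunctional d (X ^ 1) = 0 := by rw [hX, sphereMean_last_pow_one]
      rw [show X * (C a * X ^ 0) = a • (X ^ 1 : ℝ[X]) by rw [smul_eq_C_mul]; ring, map_smul, this]
      simp
    | succ k =>
      have h := sphereMean_last_pow_add_two (d := d) k
      rw [← hX, ← hX] at h
      have e1 : (1 - X ^ 2) * (C a * (C ((k + 1 : ℕ) : ℝ) * X ^ (k + 1 - 1))) =
          (a * (k + 1)) • (X ^ k : ℝ[X]) - (a * (k + 1)) • (X ^ (k + 2) : ℝ[X]) := by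
        simp only [smul_eq_C_mul, Nat.add_sub_cancel, map_mul]
        push_cast
        ring
      have e2 : X * (C a * X ^ (k + 1)) = a • (X ^ (k + 2) : ℝ[X]) := by
        rw [smul_eq_C_mul]; ring
      rw [e1, e2, map_sub, map_smul, map_smul, map_smul]
      simp only [smul_eq_mul]
      linear_combination (-a) * h

/-- Differentiating the additional weight changes the constant `d` into `2 * M + d`, which is `2 *
lam + 1` for `lam = M + (d - 1) / 2`. This is why the powers of the sines shift the Gegenbauer
parameter. -/
theorem lastFunctional_pow_mul_pearson (d M : ℕ) (q : ℝ[X]) :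
    lastFunctional d ((1 - X ^ 2) ^ M * ((1 - X ^ 2) * derivative q)) =
      (2 * M + d) * lastFunctional d ((1 - X ^ 2) ^ M * (X * q)) := by
  have h := lastFunctional_pearson d ((1 - X ^ 2) ^ M * q)
  have e : (1 - X ^ 2) * derivative ((1 - X ^ 2) ^ M * q) =
      (1 - X ^ 2) ^ M * ((1 - X ^ 2) * derivative q) -
        (2 * M : ℝ) • ((1 - X ^ 2 : ℝ[X]) ^ M * (X * q)) := by
    rw [derivative_mul, smul_eq_C_mul]
    cases M with
    | zero => simp
    | succ M =>
      rw [derivative_pow_succ]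
      simp only [derivative_sub, derivative_one, derivative_X_pow, map_mul, map_natCast]
      push_cast
      simp [show (C 2 : ℝ[X]) = 2 from rfl]
      ring
  rw [e, map_sub, map_smul, smul_eq_mul, show X * ((1 - X ^ 2) ^ M * q) =
    (1 - X ^ 2) ^ M * (X * q) by ring] at h
  linarith

/-- The weighted Pearson identity for `q = X` is a recurrence in `M`. -/
theorem lastFunctional_one_sub_sq_pow {d : ℕ} (hd : 0 < d) (M : ℕ) :
    lastFunctional d ((1 - X ^ 2) ^ M) =
      pochhammerSymbol (d / 2) M / pochhammerSymbol ((d + 1) / 2) M := by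
  have hd' : (0 : ℝ) < d := by exact_mod_cast hd
  induction M with
  | zero => simp [pochhammerSymbol_zero, lastFunctional_one]
  | succ M ih =>
    have h := lastFunctional_pow_mul_pearson d M X
    rw [derivative_X, mul_one, ← pow_succ, show (1 - X ^ 2 : ℝ[X]) ^ M * (X * X) =
      (1 - X ^ 2) ^ M - (1 - X ^ 2) ^ (M + 1) by ring, map_sub, ih] at h
    have h1 := pochhammerSymbol_pos (show (0 : ℝ) < (d + 1) / 2 by positivity) M
    have h2 : (2 * (M : ℝ) + d + 1) * lastFunctional d ((1 - X ^ 2) ^ (M + 1)) =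
      (2 * M + d) * (pochhammerSymbol (d / 2) M / pochhammerSymbol ((d + 1) / 2) M) := by linarith
    have h3 : (2 * (M : ℝ) + d + 1) ≠ 0 := by positivity
    refine mul_left_cancel₀ h3 (h2.trans ?_)
    rw [pochhammerSymbol_succ, pochhammerSymbol_succ]
    field_simp
    ring

theorem lastFunctional_gegPoly {d : ℕ} (hd : 2 ≤ d) (M n m : ℕ) {lam : ℝ}
    (hlam : lam = M + ((d : ℝ) - 1) / 2) :
    lastFunctional d ((1 - X ^ 2) ^ M * (gegPoly lam n * gegPoly lam m)) =
      if n = m then pochhammerSymbol (2 * lam) n * lam / (n.factorial * (n + lam)) *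
        (pochhammerSymbol (d / 2) M / pochhammerSymbol ((d + 1) / 2) M) else 0 := by
  have hd' : (2 : ℝ) ≤ d := by exact_mod_cast hd
  have hl : 0 < lam := by
    rw [hlam]
    have : (0 : ℝ) ≤ M := M.cast_nonneg
    linarith
  set L : ℝ[X] →ₗ[ℝ] ℝ := (lastFunctional d) ∘ₗ LinearMap.mulLeft ℝ ((1 - X ^ 2) ^ M) with hLdef
  have hL : ∀ q, L ((1 - X ^ 2) * derivative q) = (2 * lam + 1) * L (X * q) := fun q => by
    simp only [hLdef, LinearMap.comp_apply, LinearMap.mulLeft_apply]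
    rw [lastFunctional_pow_mul_pearson, hlam]
    ring
  change L (gegPoly lam n * gegPoly lam m) = _
  split_ifs with h
  · subst h
    rw [functional_gegPoly_sq hl hL, ← lastFunctional_one_sub_sq_pow (by omega)]
    simp [hLdef]
  · exact functional_gegPoly_eq_zero hl hL h

end LastCoordinate

/-! ### Products of functions of the hyperspherical coordinates -/

theorem headNorm_initPart {d : ℕ} (x : EuclideanSpace ℝ (Fin (d + 1))) (i : Fin d) :
    headNorm (initPart x) i = headNorm x i.castSucc := by
  have h : ¬ Fin.last d ≤ i.castSucc := not_le.2 (Fin.castSucc_lt_last i)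
  simp only [headNorm, Finset.sum_filter, Fin.sum_univ_castSucc, initPart, if_neg h, add_zero,
    Fin.castSucc_le_castSucc_iff]

theorem headNorm_last {d : ℕ} (x : EuclideanSpace ℝ (Fin (d + 1))) :
    headNorm x (Fin.last d) = ‖x‖ := by
  simp [headNorm, EuclideanSpace.norm_eq, Fin.le_last]

theorem headNorm_smul {d : ℕ} (c : ℝ) (x : EuclideanSpace ℝ (Fin d)) (i : Fin d) :
    headNorm (c • x) i = |c| * headNorm x i := by
  rw [headNorm, headNorm, ← Real.sqrt_sq_eq_abs, ← Real.sqrt_mul (sq_nonneg c), Finset.mul_sum]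
  simp [mul_pow]

theorem azimuth_initPart {d : ℕ} (hd : 2 ≤ d) (x : EuclideanSpace ℝ (Fin (d + 1))) :
    azimuth hd (initPart x) = azimuth (hd.trans d.le_succ) x := rfl

theorem azimuth_smul {d : ℕ} (hd : 2 ≤ d) {c : ℝ} (hc : 0 < c) (x : EuclideanSpace ℝ (Fin d)) :
    azimuth hd (c • x) = azimuth hd x := by
  rw [azimuth, azimuth, ← Complex.arg_real_mul (⟨x ⟨1, by omega⟩, x ⟨0, by omega⟩⟩ : ℂ) hc]
  congr 1
  apply Complex.ext <;> simp

theorem abs_div_headNorm_le {d : ℕ} (x : EuclideanSpace ℝ (Fin d)) (i : Fin d) :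
    |x i / headNorm x i| ≤ 1 := by
  rw [abs_div, abs_of_nonneg (show 0 ≤ headNorm x i from Real.sqrt_nonneg _)]
  exact div_le_one_of_le₀ (Real.abs_le_sqrt
    (Finset.single_le_sum (f := fun l => x l ^ 2) (fun l _ => sq_nonneg _) (by simp)))
    (Real.sqrt_nonneg _)

theorem measurable_azimuth {d : ℕ} (hd : 2 ≤ d) : Measurable (azimuth hd) := by
  have h : Measurable fun x : EuclideanSpace ℝ (Fin d) =>
      (⟨x ⟨1, by omega⟩, x ⟨0, by omega⟩⟩ : ℂ) :=
    Complex.measurableEquivRealProd.symm.measurable.comp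
      (Measurable.prodMk (by fun_prop) (by fun_prop))
  exact Complex.measurable_arg.comp h

theorem measurable_headNorm {d : ℕ} (i : Fin d) :
    Measurable fun x : EuclideanSpace ℝ (Fin d) => headNorm x i := by
  unfold headNorm
  fun_prop

/-- A product of functions of the hyperspherical coordinates, expressed by means of the azimuth and
of the cosines of the polar angles. -/
def angularProd (z : ℝ → ℝ) (g : ℕ → ℝ → ℝ) {d : ℕ} (hd : 2 ≤ d)
    (x : EuclideanSpace ℝ (Fin d)) : ℝ :=
  z (azimuth hd x) * ∏ i : Fin d, if 2 ≤ i.val then g i.val (x i / headNorm x i) else 1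

theorem angularProd_succ (z : ℝ → ℝ) (g : ℕ → ℝ → ℝ) {d : ℕ} (hd : 2 ≤ d)
    (x : EuclideanSpace ℝ (Fin (d + 1))) :
    angularProd z g (hd.trans d.le_succ) x =
      angularProd z g hd (initPart x) * g d (x (Fin.last d) / ‖x‖) := by
  rw [angularProd, angularProd, Fin.prod_univ_castSucc, ← mul_assoc, azimuth_initPart]
  simp only [Fin.val_castSucc, Fin.val_last, if_pos hd, headNorm_last, headNorm_initPart]
  rfl

theorem angularProd_smul (z : ℝ → ℝ) (g : ℕ → ℝ → ℝ) {d : ℕ} (hd : 2 ≤ d) {c : ℝ} (hc : 0 < c)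
    (x : EuclideanSpace ℝ (Fin d)) : angularProd z g hd (c • x) = angularProd z g hd x := by
  simp only [angularProd, azimuth_smul hd hc, headNorm_smul, abs_of_pos hc, PiLp.smul_apply,
    smul_eq_mul, mul_div_mul_left _ _ hc.ne']

theorem measurable_angularProd {z : ℝ → ℝ} {g : ℕ → ℝ → ℝ} (hz : Measurable z)
    (hg : ∀ i, Measurable (g i)) {d : ℕ} (hd : 2 ≤ d) : Measurable (angularProd z g hd) := by
  unfold angularProd
  refine (hz.comp (measurable_azimuth hd)).mul (Finset.measurable_fun_prod _ fun i _ => ?_)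
  split_ifs
  · exact (hg _).comp (Measurable.div (by fun_prop) (measurable_headNorm i))
  · exact measurable_const

theorem exists_abs_angularProd_le {z : ℝ → ℝ} {g : ℕ → ℝ → ℝ} (hz : ∃ C, ∀ s, |z s| ≤ C)
    (hg : ∀ i, ∃ C, ∀ t, |t| ≤ 1 → |g i t| ≤ C) {d : ℕ} (hd : 2 ≤ d) :
    ∃ C, ∀ x, |angularProd z g hd x| ≤ C := by
  obtain ⟨C, hC⟩ := hz
  choose D hD using hg
  refine ⟨C * ∏ i : Fin d, if 2 ≤ i.val then D i.val else 1, fun x => ?_⟩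
  rw [angularProd, abs_mul, Finset.abs_prod]
  refine mul_le_mul (hC _) (Finset.prod_le_prod (fun _ _ => abs_nonneg _) fun i _ => ?_)
    (Finset.prod_nonneg fun _ _ => abs_nonneg _) ((abs_nonneg _).trans (hC 0))
  split_ifs
  · exact hD _ _ (abs_div_headNorm_le x i)
  · simp

/-- Induction on the dimension, splitting off the last coordinate each time. The family `g` is
indexed by `ℕ` so that the same family serves in every dimension. -/
theorem sphereMean_angularProd {z : ℝ → ℝ} {g : ℕ → ℝ → ℝ} (hz : Measurable z)
    (hzb : ∃ C, ∀ s, |z s| ≤ C) (hg : ∀ i, Measurable (g i))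
    (hgb : ∀ i, ∃ C, ∀ t, |t| ≤ 1 → |g i t| ≤ C) {d : ℕ} (hd : 2 ≤ d) :
    sphereMean d (angularProd z g hd) =
      sphereMean 2 (fun x => z (azimuth le_rfl x)) *
        ∏ i ∈ Finset.Ico 2 d, sphereMean (i + 1) fun x => g i (x (Fin.last i) / ‖x‖) := by
  induction d, hd using Nat.le_induction with
  | base =>
    rw [Finset.Ico_self, Finset.prod_empty, mul_one]
    congr 1
    ext x
    simp [angularProd, Fin.prod_univ_two]
  | succ d hd ih =>
    obtain ⟨C, hC⟩ := exists_abs_angularProd_le hzb hgb hd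
    obtain ⟨D, hD⟩ := hgb d
    rw [Finset.prod_Ico_succ_top hd, ← mul_assoc, ← ih,
      ← sphereMean_initPart_mul (by omega) _ (measurable_angularProd hz hg hd) hC
        (fun x hx => (angularProd_smul z g hd (inv_pos.2 (norm_pos_iff.2 hx)) x).symm) _ (hg d) hD]
    congr 1
    ext x
    exact angularProd_succ z g hd x

/-! ### Trigonometric integrals -/

theorem integral_cos_int_mul (n : ℤ) :
    ∫ s in Set.Ioo (-Real.pi) Real.pi, Real.cos (n * s) = if n = 0 then 2 * Real.pi else 0 := by
  have hpi := Real.pi_pos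
  rw [← integral_Ioc_eq_integral_Ioo, ← intervalIntegral.integral_of_le (by linarith)]
  split_ifs with h
  · subst h
    simp; ring
  · have h' : (n : ℝ) ≠ 0 := by exact_mod_cast h
    rw [intervalIntegral.integral_comp_mul_left (fun s => Real.cos s) h', integral_cos]
    simp [Real.sin_int_mul_pi]

theorem integral_sin_int_mul (n : ℤ) :
    ∫ s in Set.Ioo (-Real.pi) Real.pi, Real.sin (n * s) = 0 := by
  have hpi := Real.pi_pos
  rw [← integral_Ioc_eq_integral_Ioo, ← intervalIntegral.integral_of_le (by linarith)]
  rcases eq_or_ne n 0 with rfl | h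
  · simp
  · have h' : (n : ℝ) ≠ 0 := by exact_mod_cast h
    rw [intervalIntegral.integral_comp_mul_left (fun s => Real.sin s) h', integral_sin]
    simp

theorem integrableOn_Ioo_of_continuous {z : ℝ → ℝ} (hz : Continuous z) (a b : ℝ) :
    IntegrableOn z (Set.Ioo a b) :=
  (hz.integrableOn_Icc (a := a) (b := b)).mono_set Set.Ioo_subset_Icc_self

theorem integral_cos_mul_cos (a b : ℤ) :
    ∫ s in Set.Ioo (-Real.pi) Real.pi, Real.cos (a * s) * Real.cos (b * s) =
      ((if a - b = 0 then 2 * Real.pi else 0) + (if a + b = 0 then 2 * Real.pi else 0)) / 2 := by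
  rw [← integral_cos_int_mul, ← integral_cos_int_mul, ← integral_add
    (integrableOn_Ioo_of_continuous (by fun_prop) _ _)
    (integrableOn_Ioo_of_continuous (by fun_prop) _ _), ← integral_div]
  refine integral_congr_ae (ae_of_all _ fun s => ?_)
  simp only [Int.cast_sub, Int.cast_add, sub_mul, add_mul, Real.cos_sub, Real.cos_add]
  ring

theorem integral_sin_mul_sin (a b : ℤ) :
    ∫ s in Set.Ioo (-Real.pi) Real.pi, Real.sin (a * s) * Real.sin (b * s) =
      ((if a - b = 0 then 2 * Real.pi else 0) - (if a + b = 0 then 2 * Real.pi else 0)) / 2 := by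
  rw [← integral_cos_int_mul, ← integral_cos_int_mul, ← integral_sub
    (integrableOn_Ioo_of_continuous (by fun_prop) _ _)
    (integrableOn_Ioo_of_continuous (by fun_prop) _ _), ← integral_div]
  refine integral_congr_ae (ae_of_all _ fun s => ?_)
  simp only [Int.cast_sub, Int.cast_add, sub_mul, add_mul, Real.cos_sub, Real.cos_add]
  ring

theorem integral_sin_mul_cos (a b : ℤ) :
    ∫ s in Set.Ioo (-Real.pi) Real.pi, Real.sin (a * s) * Real.cos (b * s) = 0 := by
  have h : (0 : ℝ) = ((∫ s in Set.Ioo (-Real.pi) Real.pi, Real.sin ((a - b : ℤ) * s)) +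
      ∫ s in Set.Ioo (-Real.pi) Real.pi, Real.sin ((a + b : ℤ) * s)) / 2 := by
    rw [integral_sin_int_mul, integral_sin_int_mul]; simp
  rw [h, ← integral_add
    (integrableOn_Ioo_of_continuous (by fun_prop) _ _)
    (integrableOn_Ioo_of_continuous (by fun_prop) _ _), ← integral_div]
  refine integral_congr_ae (ae_of_all _ fun s => ?_)
  simp only [Int.cast_sub, Int.cast_add, sub_mul, add_mul, Real.sin_sub, Real.sin_add]
  ring

/-- The sine has frequency at least one, thanks to the shift by one, so only the constant function
has mean square `1` instead of `1 / 2`. -/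
theorem sphereMean_zetaFun_mul {p : ℕ} (hp : 2 ≤ p) {m m' : Fin p → ℕ}
    (hm : m ⟨p - 1, by omega⟩ ≤ 1) (hm' : m' ⟨p - 1, by omega⟩ ≤ 1) :
    sphereMean 2 (fun x => zetaFun hp m (azimuth le_rfl x) * zetaFun hp m' (azimuth le_rfl x)) =
      if m ⟨p - 2, by omega⟩ = m' ⟨p - 2, by omega⟩ ∧ m ⟨p - 1, by omega⟩ = m' ⟨p - 1, by omega⟩
      then (if 0 < m ⟨p - 2, by omega⟩ + m ⟨p - 1, by omega⟩ then 2 else 1)⁻¹ else 0 := by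
  rw [sphereMean_azimuth fun s => zetaFun hp m s * zetaFun hp m' s]
  have hpi := Real.pi_pos
  unfold zetaFun
  generalize m ⟨p - 2, by omega⟩ = a, m' ⟨p - 2, by omega⟩ = b at *
  generalize m ⟨p - 1, by omega⟩ = e, m' ⟨p - 1, by omega⟩ = e' at *
  have hcc := integral_cos_mul_cos a b
  have hss := integral_sin_mul_sin (a + 1) (b + 1)
  have hsc := integral_sin_mul_cos (a + 1) b
  have hcs := integral_sin_mul_cos (b + 1) a
  push_cast at hcc hss hsc hcs
  interval_cases e <;> interval_cases e'
  · simp only [if_true, hcc, and_true, add_zero]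
    rcases eq_or_ne a b with rfl | h
    · rcases Nat.eq_zero_or_pos a with rfl | ha
      · simp; field_simp
      · rw [if_pos (by ring), if_neg (by omega), if_pos rfl, if_pos ha]; field_simp; ring
    · rw [if_neg (by omega), if_neg (by omega), if_neg h]; simp
  · simp only [if_true, one_ne_zero, if_false, zero_ne_one, and_false]
    rw [← hcs.symm.trans (integral_congr_ae (ae_of_all _ fun s => mul_comm _ _)), mul_zero]
  · simp only [if_true, one_ne_zero, if_false, and_false, hsc, mul_zero]
  · simp only [one_ne_zero, if_false, hss, and_true]
    rw [if_neg (c := (a : ℤ) + 1 + (b + 1) = 0) (by omega), if_pos (c := 0 < a + 1) (by omega)]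
    rcases eq_or_ne a b with rfl | h
    · rw [if_pos (by ring), if_pos rfl]; field_simp; ring
    · rw [if_neg (by omega), if_neg h]; simp

/-! ### Orthonormality of the spherical harmonics -/

/-- The factor of `φ_m` belonging to the index `j`, as a function of the cosine of the angle. -/
def polarFactor {p : ℕ} (m : Fin p → ℕ) (j : Fin p) (t : ℝ) : ℝ :=
  Real.sqrt (1 - t ^ 2) ^ tailSum m j * gegenbauer (gegParam m j) (m j) t

theorem continuous_gegenbauer (lam : ℝ) (q : ℕ) : Continuous (gegenbauer lam q) := by
  unfold gegenbauer
  fun_prop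

theorem continuous_polarFactor {p : ℕ} (m : Fin p → ℕ) (j : Fin p) :
    Continuous (polarFactor m j) := by
  have := continuous_gegenbauer (gegParam m j) (m j)
  unfold polarFactor
  fun_prop

theorem continuous_zetaFun {p : ℕ} (hp : 2 ≤ p) (m : Fin p → ℕ) : Continuous (zetaFun hp m) := by
  unfold zetaFun
  split_ifs <;> fun_prop

theorem abs_zetaFun_le_one {p : ℕ} (hp : 2 ≤ p) (m : Fin p → ℕ) (s : ℝ) :
    |zetaFun hp m s| ≤ 1 := by
  unfold zetaFun
  split_ifs
  exacts [Real.abs_cos_le_one _, Real.abs_sin_le_one _]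

theorem polarFactor_cos {p : ℕ} (m : Fin p → ℕ) (x : EuclideanSpace ℝ (Fin p)) (i j : Fin p) :
    Real.sin (polarAngle x i) ^ tailSum m j *
      gegenbauer (gegParam m j) (m j) (Real.cos (polarAngle x i)) =
    polarFactor m j (x i / headNorm x i) := by
  obtain ⟨h1, h2⟩ := abs_le.1 (abs_div_headNorm_le x i)
  rw [polarFactor, polarAngle, Real.sin_arccos, Real.cos_arccos h1 h2]

/-- `polarFactor`, indexed by the number of the coordinate that it depends on. -/
def coordFactor {p : ℕ} (m : Fin p → ℕ) (i : ℕ) (t : ℝ) : ℝ :=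
  if h : i < p then polarFactor m (Fin.rev ⟨i, h⟩) t else 0

theorem coordFactor_rev {p : ℕ} (m : Fin p → ℕ) (j : Fin p) (t : ℝ) :
    coordFactor m j.rev t = polarFactor m j t := by
  simp only [coordFactor, j.rev.isLt, dif_pos, Fin.eta, Fin.rev_rev]

theorem continuous_coordFactor {p : ℕ} (m : Fin p → ℕ) (i : ℕ) :
    Continuous (coordFactor m i) := by
  unfold coordFactor
  split_ifs
  · exact continuous_polarFactor _ _
  · exact continuous_const

theorem sphHarm_eq_angularProd {p : ℕ} (hp : 2 ≤ p) (m : Fin p → ℕ) (x : USphere p) :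
    sphHarm hp m x =
      Real.sqrt (normConst hp m) * angularProd (zetaFun hp m) (coordFactor m) hp x.1 := by
  rw [sphHarm, angularProd, mul_assoc]
  congr 2
  simp only [polarFactor_cos]
  rw [Finset.prod_filter, ← Equiv.prod_comp Fin.revPerm]
  refine Finset.prod_congr rfl fun i _ => ?_
  have : (i.rev : ℕ) + 2 < p ↔ 2 ≤ i.val := by rw [Fin.val_rev]; omega
  simp only [Fin.revPerm_apply, this, coordFactor, i.isLt, dif_pos, Fin.rev_rev]

theorem measurable_sphHarm {p : ℕ} (hp : 2 ≤ p) (m : Fin p → ℕ) : Measurable (sphHarm hp m) := by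
  rw [funext (sphHarm_eq_angularProd hp m)]
  exact ((measurable_angularProd (continuous_zetaFun hp m).measurable
    (fun i => (continuous_coordFactor m i).measurable) hp).comp measurable_subtype_coe).const_mul _

theorem exists_abs_sphHarm_le {p : ℕ} (hp : 2 ≤ p) (m : Fin p → ℕ) :
    ∃ C, ∀ x, |sphHarm hp m x| ≤ C := by
  obtain ⟨C, hC⟩ := exists_abs_angularProd_le ⟨1, abs_zetaFun_le_one hp m⟩
    (fun i => exists_abs_le_of_continuous (continuous_coordFactor m i)) hp
  refine ⟨Real.sqrt (normConst hp m) * C, fun x => ?_⟩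
  rw [sphHarm_eq_angularProd, abs_mul, abs_of_nonneg (Real.sqrt_nonneg _)]
  gcongr
  exact hC _

/-- Equal tail sums give both factors the same Gegenbauer parameter, and the two powers of the sine
combine into the polynomial `(1 - t ^ 2) ^ tailSum m j`. So `lastFunctional_gegPoly` applies, on the
sphere of dimension `d = p - 1 - j`. -/
theorem sphereMean_coordFactor_mul {p : ℕ} {m m' : Fin p → ℕ} (j : Fin p) (hj : j.val + 2 < p)
    (ht : tailSum m j = tailSum m' j) :
    sphereMean (j.rev.val + 1) (fun x => coordFactor m j.rev (x (Fin.last _) / ‖x‖) *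
        coordFactor m' j.rev (x (Fin.last _) / ‖x‖)) =
      if m j = m' j then
        (((m j).factorial : ℝ) *
          pochhammerSymbol (((p : ℝ) - ((j : ℕ) + 1) + 1) / 2) (tailSum m j) *
          ((m j : ℝ) + gegParam m j) /
        (pochhammerSymbol (2 * gegParam m j) (m j) *
          pochhammerSymbol (((p : ℝ) - ((j : ℕ) + 1)) / 2) (tailSum m j) *
          gegParam m j))⁻¹ else 0 := by
  have hval : (j.rev.val : ℝ) = (p : ℝ) - (j + 1) := by
    rw [Fin.val_rev, Nat.cast_sub (by omega)]; push_cast; ring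
  have hlam : gegParam m j = (tailSum m j : ℝ) + ((j.rev.val : ℝ) - 1) / 2 := by
    rw [hval, gegParam]
  have hlam' : gegParam m' j = gegParam m j := by rw [gegParam, gegParam, ht]
  have h := lastFunctional_gegPoly (d := j.rev.val) (by rw [Fin.val_rev]; omega) (tailSum m j)
    (m j) (m' j) hlam
  rw [lastFunctional_apply] at h
  have e : (fun x : EuclideanSpace ℝ (Fin (j.rev.val + 1)) =>
      coordFactor m j.rev (x (Fin.last _) / ‖x‖) *
        coordFactor m' j.rev (x (Fin.last _) / ‖x‖)) =
      fun x => Polynomial.eval (x (Fin.last _) / ‖x‖) ((1 - Polynomial.X ^ 2) ^ tailSum m j *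
        (gegPoly (gegParam m j) (m j) * gegPoly (gegParam m j) (m' j))) := by
    ext x
    have ht1 : 0 ≤ 1 - (x (Fin.last _) / ‖x‖) ^ 2 := by
      have := (sq_le_one_iff_abs_le_one _).2 (abs_last_div_norm_le x)
      linarith
    simp only [coordFactor_rev, polarFactor, ← ht, hlam',
      Polynomial.eval_mul, Polynomial.eval_pow, Polynomial.eval_sub, Polynomial.eval_one,
      Polynomial.eval_X, eval_gegPoly]
    generalize x (Fin.last _) / ‖x‖ = t at *
    nth_rewrite 3 [← Real.sq_sqrt ht1]
    rw [← pow_mul, mul_comm 2, pow_mul]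
    ring
  rw [e, h]
  split_ifs
  · rw [hval]
    field_simp
  · rfl

theorem prod_Ico_two_eq_prod_rev {p : ℕ} (F : ℕ → ℝ) :
    ∏ i ∈ Finset.Ico 2 p, F i = ∏ j : Fin p with j.val + 2 < p, F j.rev := by
  symm
  refine Finset.prod_bij (fun j _ => j.rev.val) ?_ ?_ ?_ fun _ _ => rfl
  · intro j hj
    simp only [Finset.mem_filter, Finset.mem_univ, true_and] at hj
    rw [Finset.mem_Ico, Fin.val_rev]
    omega
  · intro a _ b _ hab
    exact Fin.rev_injective (Fin.ext hab)
  · intro i hi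
    rw [Finset.mem_Ico] at hi
    refine ⟨Fin.rev ⟨i, hi.2⟩, ?_, by rw [Fin.rev_rev]⟩
    simp only [Finset.mem_filter, Finset.mem_univ, true_and, Fin.val_rev]
    omega

theorem gegParam_pos {p : ℕ} (m : Fin p → ℕ) {j : Fin p} (hj : j.val + 2 < p) :
    0 < gegParam m j := by
  have h : (j : ℝ) + 2 < p := by exact_mod_cast hj
  have : (0 : ℝ) ≤ tailSum m j := Nat.cast_nonneg _
  rw [gegParam]
  linarith

theorem tailSum_congr {p : ℕ} {m m' : Fin p → ℕ} {j : Fin p} (h : ∀ i, j < i → m i = m' i) :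
    tailSum m j = tailSum m' j :=
  Finset.sum_congr rfl fun i hi => h i (by simpa using hi)

/-- The spherical harmonics `φ_m` are orthonormal with respect to the uniform distribution. -/
theorem sphHarm_orthonormal {p : ℕ} (hp : 2 ≤ p) {m m' : Fin p → ℕ}
    (hm : m ⟨p - 1, by omega⟩ ≤ 1) (hm' : m' ⟨p - 1, by omega⟩ ≤ 1) :
    ((surfaceMeasure p).real Set.univ)⁻¹ *
      ∫ u, sphHarm hp m u * sphHarm hp m' u ∂surfaceMeasure p = if m = m' then 1 else 0 := by
  have hprod : ∀ u : USphere p, sphHarm hp m u * sphHarm hp m' u =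
      Real.sqrt (normConst hp m) * Real.sqrt (normConst hp m') *
        angularProd (fun s => zetaFun hp m s * zetaFun hp m' s)
          (fun i t => coordFactor m i t * coordFactor m' i t) hp u.1 := fun u => by
    simp only [sphHarm_eq_angularProd, angularProd]
    have : ∀ i : Fin p, (if 2 ≤ i.val then coordFactor m i (u.1 i / headNorm u.1 i) *
          coordFactor m' i (u.1 i / headNorm u.1 i) else 1) =
        (if 2 ≤ i.val then coordFactor m i (u.1 i / headNorm u.1 i) else 1) *
          (if 2 ≤ i.val then coordFactor m' i (u.1 i / headNorm u.1 i) else 1) := fun i => by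
      split_ifs <;> simp
    rw [Finset.prod_congr rfl fun i _ => this i, Finset.prod_mul_distrib]
    ring
  have hmean := sphereMean_angularProd
    (z := fun s => zetaFun hp m s * zetaFun hp m' s)
    (g := fun i t => coordFactor m i t * coordFactor m' i t)
    ((continuous_zetaFun hp m).mul (continuous_zetaFun hp m')).measurable
    ⟨1, fun s => by
      rw [abs_mul]
      exact mul_le_one₀ (abs_zetaFun_le_one hp m s) (abs_nonneg _) (abs_zetaFun_le_one hp m' s)⟩
    (fun i => ((continuous_coordFactor m i).mul (continuous_coordFactor m' i)).measurable)
    (fun i => exists_abs_le_of_continuous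
      ((continuous_coordFactor m i).mul (continuous_coordFactor m' i))) hp
  simp_rw [hprod]
  rw [integral_const_mul, mul_left_comm, ← sphereMean, hmean,
    sphereMean_zetaFun_mul hp hm hm', prod_Ico_two_eq_prod_rev]
  by_cases hz : m ⟨p - 2, by omega⟩ = m' ⟨p - 2, by omega⟩ ∧
      m ⟨p - 1, by omega⟩ = m' ⟨p - 1, by omega⟩
  swap
  -- Different azimuthal factors are already orthogonal on the circle.
  · rw [if_neg hz, if_neg, zero_mul, mul_zero]
    rintro rfl
    exact hz ⟨rfl, rfl⟩
  rw [if_pos hz]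
  by_cases hmm : m = m'
  · subst hmm
    have hB : 0 ≤ normConst hp m := by
      unfold normConst
      refine mul_nonneg (by split_ifs <;> norm_num) (Finset.prod_nonneg fun j hj => ?_)
      simp only [Finset.mem_filter, Finset.mem_univ, true_and] at hj
      have h1 := gegParam_pos m hj
      have h : (j : ℝ) + 2 < p := by exact_mod_cast hj
      have h2 := pochhammerSymbol_pos (a := 2 * gegParam m j) (by linarith) (m j)
      have h3 := pochhammerSymbol_pos (a := ((p : ℝ) - ((j : ℕ) + 1) + 1) / 2) (by linarith)
        (tailSum m j)
      have h4 := pochhammerSymbol_pos (a := ((p : ℝ) - ((j : ℕ) + 1)) / 2) (by linarith)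
        (tailSum m j)
      positivity
    rw [if_pos rfl, Real.mul_self_sqrt hB, normConst, mul_mul_mul_comm,
      ← Finset.prod_mul_distrib, Finset.prod_eq_one, mul_one, mul_inv_cancel₀]
    · split_ifs <;> norm_num
    · intro j hj
      simp only [Finset.mem_filter, Finset.mem_univ, true_and] at hj
      rw [sphereMean_coordFactor_mul j hj rfl, if_pos rfl]
      have h1 := gegParam_pos m hj
      have h : (j : ℝ) + 2 < p := by exact_mod_cast hj
      have h2 := pochhammerSymbol_pos (a := 2 * gegParam m j) (by linarith) (m j)
      have h3 := pochhammerSymbol_pos (a := ((p : ℝ) - ((j : ℕ) + 1) + 1) / 2) (by linarith)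
        (tailSum m j)
      have h4 := pochhammerSymbol_pos (a := ((p : ℝ) - ((j : ℕ) + 1)) / 2) (by linarith)
        (tailSum m j)
      exact mul_inv_cancel₀ (by positivity)
  · rw [if_neg hmm]
    have hne : (Finset.univ.filter fun j => m j ≠ m' j).Nonempty := by
      obtain ⟨j, hj⟩ := Function.ne_iff.1 hmm
      exact ⟨j, by simpa using hj⟩
    -- At the last index where `m` and `m'` differ the tail sums agree, so the corresponding
    -- one-dimensional mean vanishes. The index is a polar one, because the last two entries agree
    -- by `hz`.
    obtain ⟨j, hj, hmax⟩ := Finset.exists_max_image _ id hne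
    simp only [Finset.mem_filter, Finset.mem_univ, true_and, id] at hj hmax
    have hj2 : j.val + 2 < p := by
      by_contra hcon
      have : j = ⟨p - 2, by omega⟩ ∨ j = ⟨p - 1, by omega⟩ := by
        simp only [Fin.ext_iff]; omega
      rcases this with h | h <;> rw [h] at hj
      exacts [hj hz.1, hj hz.2]
    have ht : tailSum m j = tailSum m' j := tailSum_congr fun i hi => by
      by_contra hcon
      exact absurd (hmax i hcon) (not_le.2 hi)
    have h0 := sphereMean_coordFactor_mul j hj2 ht
    rw [if_neg hj] at h0
    rw [Finset.prod_eq_zero (i := j) (by simpa using hj2) h0, mul_zero, mul_zero]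

/-- The constant harmonic: centering of the others becomes a case of orthonormality. -/
theorem sphHarm_zero {p : ℕ} (hp : 2 ≤ p) (x : USphere p) : sphHarm hp 0 x = 1 := by
  have ht : ∀ j : Fin p, tailSum (0 : Fin p → ℕ) j = 0 := fun j => by simp [tailSum]
  have hprod1 : ∏ j : Fin p with j.val + 2 < p,
      (Real.sin (polarAngle x.1 j.rev) ^ tailSum (0 : Fin p → ℕ) j *
        gegenbauer (gegParam (0 : Fin p → ℕ) j) ((0 : Fin p → ℕ) j)
          (Real.cos (polarAngle x.1 j.rev))) = 1 := by
    refine Finset.prod_eq_one fun j hj => ?_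
    simp only [Finset.mem_filter, Finset.mem_univ, true_and] at hj
    rw [ht, Pi.zero_apply, ← eval_gegPoly, gegPoly_zero (gegParam_pos _ hj)]
    simp
  have hB : normConst hp 0 = 1 := by
    rw [normConst]
    refine (congrArg₂ (· * ·) (by simp) (Finset.prod_eq_one fun j hj => ?_)).trans (one_mul 1)
    simp only [Finset.mem_filter, Finset.mem_univ, true_and] at hj
    have := gegParam_pos (0 : Fin p → ℕ) hj
    simp [ht, pochhammerSymbol_zero, this.ne']
  rw [sphHarm, hprod1, hB]
  simp [zetaFun]

/-- The spherical harmonics of positive degree are centered. -/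
theorem integral_sphHarm_eq_zero {p : ℕ} (hp : 2 ≤ p) {m : Fin p → ℕ}
    (hm : m ⟨p - 1, by omega⟩ ≤ 1) (h0 : m ≠ 0) :
    ((surfaceMeasure p).real Set.univ)⁻¹ * ∫ u, sphHarm hp m u ∂surfaceMeasure p = 0 := by
  have h := sphHarm_orthonormal hp hm (m' := 0) (by simp)
  rw [if_neg h0] at h
  simpa only [sphHarm_zero, mul_one] using h

/-! ### Rotationally symmetric distributions close to the uniform one -/

/-- Dominated convergence. Continuity at the single point `0` bounds `f` by `2` near `0`, and the
arguments of `f` are at most `|κ n| * ‖θ‖`, uniformly over the sphere. -/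
theorem tendsto_integral_mul_angular {p : ℕ} (θ : EuclideanSpace ℝ (Fin p)) {κ : ℕ → ℝ}
    (hκ : Tendsto κ atTop (𝓝 0)) {f : ℝ → ℝ} (hf : IsAngularFunction f) (hfc : ContinuousAt f 0)
    {G : USphere p → ℝ} (hG : Measurable G) {C : ℝ} (hC : ∀ x, |G x| ≤ C) :
    Tendsto (fun n => ∫ u, f (κ n * inner ℝ u.1 θ) * G u ∂surfaceMeasure p) atTop
      (𝓝 (∫ u, G u ∂surfaceMeasure p)) := by
  refine tendsto_integral_filter_of_dominated_convergence (fun _ => 2 * C) ?_ ?_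
    (integrable_const _) ?_
  · exact Eventually.of_forall fun n =>
      ((hf.measurable.comp (by fun_prop)).mul hG).aestronglyMeasurable
  · have h2 : ∀ᶠ s in 𝓝 (0 : ℝ), f s < 2 :=
      hfc.eventually_lt continuousAt_const (by rw [hf.map_zero]; norm_num)
    obtain ⟨δ, hδ, hδ2⟩ := Metric.eventually_nhds_iff.1 h2
    have h3 : Tendsto (fun n => |κ n| * ‖θ‖) atTop (𝓝 0) := by
      simpa using hκ.abs.mul_const ‖θ‖
    filter_upwards [h3.eventually_lt_const hδ] with n hn
    refine ae_of_all _ fun u => ?_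
    have hu : |κ n * inner ℝ u.1 θ| < δ := by
      refine lt_of_le_of_lt ?_ hn
      rw [abs_mul]
      gcongr
      simpa using abs_real_inner_le_norm u.1 θ
    have hlt := hδ2 (y := κ n * inner ℝ u.1 θ) (by simpa [Real.dist_eq] using hu)
    rw [Real.norm_eq_abs, abs_mul, abs_of_nonneg (hf.nonneg _)]
    exact mul_le_mul hlt.le (hC u) (abs_nonneg _) zero_le_two
  · refine ae_of_all _ fun u => ?_
    have h1 : Tendsto (fun n => κ n * inner ℝ u.1 θ) atTop (𝓝 0) := by
      simpa using hκ.mul_const (inner ℝ u.1 θ)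
    have h2 := (hfc.tendsto.comp h1).mul_const (G u)
    rw [hf.map_zero, one_mul] at h2
    exact h2

theorem tendsto_integral_rotSymMeasure {p : ℕ} (hp : 0 < p) (θ : EuclideanSpace ℝ (Fin p))
    {κ : ℕ → ℝ} (hκ : Tendsto κ atTop (𝓝 0)) {f : ℝ → ℝ} (hf : IsAngularFunction f)
    (hfc : ContinuousAt f 0) {G : USphere p → ℝ} (hG : Measurable G) {C : ℝ}
    (hC : ∀ x, |G x| ≤ C) :
    Tendsto (fun n => ∫ u, G u ∂rotSymMeasure p θ (κ n) f) atTop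
      (𝓝 (((surfaceMeasure p).real Set.univ)⁻¹ * ∫ u, G u ∂surfaceMeasure p)) := by
  have h1 := tendsto_integral_mul_angular θ hκ hf hfc hG hC
  have h2 := tendsto_integral_mul_angular (p := p) θ hκ hf hfc (G := fun _ => 1) measurable_const
    (C := 1) (by simp)
  have hpos := surfaceMeasure_real_univ_pos hp
  simp only [mul_one, integral_const, smul_eq_mul] at h2
  refine ((h2.inv₀ hpos.ne').mul h1).congr' ?_
  -- Eventually the normalizing integral is positive, so the density is a genuine quotient.
  filter_upwards [h2.eventually_const_lt hpos] with n hn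
  have hm : Measurable fun u : USphere p => f (κ n * inner ℝ u.1 θ) :=
    hf.measurable.comp (by fun_prop)
  have ha : (∫⁻ v : USphere p, ENNReal.ofReal (f (κ n * inner ℝ v.1 θ)) ∂surfaceMeasure p).toReal
      = ∫ u : USphere p, f (κ n * inner ℝ u.1 θ) ∂surfaceMeasure p :=
    (integral_eq_lintegral_of_nonneg_ae (ae_of_all _ fun u => hf.nonneg _)
      hm.aestronglyMeasurable).symm
  have ha0 : ∫⁻ v : USphere p, ENNReal.ofReal (f (κ n * inner ℝ v.1 θ)) ∂surfaceMeasure p ≠ 0 := by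
    intro h
    rw [h, ENNReal.toReal_zero] at ha
    exact hn.ne ha
  rw [rotSymMeasure, integral_withDensity_eq_integral_toReal_smul
    (hm.ennreal_ofReal.div_const _)
    (ae_of_all _ fun u => ENNReal.div_lt_top ENNReal.ofReal_ne_top ha0), ← integral_const_mul]
  refine integral_congr_ae (ae_of_all _ fun u => ?_)
  simp only [ENNReal.toReal_div, ha, ENNReal.toReal_ofReal (hf.nonneg _), smul_eq_mul]
  ring

/-! ### The central limit theorem -/

/-- The vector of all spherical harmonics of degrees `1, …, K`. -/
def harmVec {p : ℕ} (hp : 2 ≤ p) (K : ℕ) (x : USphere p) : EuclideanSpace ℝ (HarmIdx p K) :=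
  WithLp.toLp 2 fun a => sphHarm hp a.2.1 x

theorem measurable_harmVec {p : ℕ} (hp : 2 ≤ p) (K : ℕ) : Measurable (harmVec hp K) :=
  (WithLp.measurable_toLp 2 _).comp (measurable_pi_lambda _ fun a => measurable_sphHarm hp a.2.1)

theorem exists_norm_harmVec_le {p : ℕ} (hp : 2 ≤ p) (K : ℕ) : ∃ C, ∀ x, ‖harmVec hp K x‖ ≤ C := by
  choose C hC using fun a : HarmIdx p K => exists_abs_sphHarm_le hp a.2.1
  refine ⟨Real.sqrt (∑ a, C a ^ 2), fun x => ?_⟩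
  rw [EuclideanSpace.norm_eq]
  refine Real.sqrt_le_sqrt (Finset.sum_le_sum fun a _ => ?_)
  exact pow_le_pow_left₀ (norm_nonneg _) (hC a x) 2

/-- The degree is recovered as the sum of the entries, so harmonics of different degrees have
different multi-indices. -/
theorem HarmIdx.ext_iff_val {p K : ℕ} {a b : HarmIdx p K} : a.2.1 = b.2.1 ↔ a = b := by
  refine ⟨fun h => ?_, fun h => h ▸ rfl⟩
  obtain ⟨⟨k, hk⟩, ⟨m, hm⟩⟩ := a
  obtain ⟨⟨l, hl⟩, ⟨m', hm'⟩⟩ := b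
  obtain rfl : m = m' := h
  have h1 := (Finset.mem_piAntidiag.1 (Finset.mem_filter.1 hm).1).1
  have h2 := (Finset.mem_piAntidiag.1 (Finset.mem_filter.1 hm').1).1
  obtain rfl : k = l := h1.symm.trans h2
  rfl

theorem HarmIdx.val_ne_zero {p K : ℕ} (a : HarmIdx p K) : a.2.1 ≠ 0 := by
  intro h
  have h1 := (Finset.mem_piAntidiag.1 (Finset.mem_filter.1 a.2.2).1).1
  have h2 := (Finset.mem_Icc.1 a.1.2).1
  rw [h] at h1
  simp only [Pi.zero_apply, Finset.sum_const_zero] at h1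
  omega

theorem HarmIdx.val_last_le {p K : ℕ} (hp : 2 ≤ p) (a : HarmIdx p K) :
    a.2.1 ⟨p - 1, by omega⟩ ≤ 1 := by
  have := (Finset.mem_filter.1 a.2.2).2 ⟨p - 1, by omega⟩ (by simp only; omega)
  omega

theorem integrable_sphHarm {p : ℕ} (hp : 2 ≤ p) (m : Fin p → ℕ) :
    Integrable (sphHarm hp m) (surfaceMeasure p) := by
  obtain ⟨C, hC⟩ := exists_abs_sphHarm_le hp m
  exact integrable_surfaceMeasure_of_bounded (measurable_sphHarm hp m) hC

theorem integrable_sphHarm_mul {p : ℕ} (hp : 2 ≤ p) (m m' : Fin p → ℕ) :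
    Integrable (fun x => sphHarm hp m x * sphHarm hp m' x) (surfaceMeasure p) := by
  obtain ⟨C, hC⟩ := exists_abs_sphHarm_le hp m
  exact (integrable_sphHarm hp m').bdd_mul (measurable_sphHarm hp m).aestronglyMeasurable
    (ae_of_all _ hC)

theorem inner_harmVec {p : ℕ} (hp : 2 ≤ p) (K : ℕ) (x : USphere p)
    (t : EuclideanSpace ℝ (HarmIdx p K)) :
    inner ℝ (harmVec hp K x) t = ∑ a, t a * sphHarm hp a.2.1 x := by
  simp [PiLp.inner_apply, harmVec]

theorem uniform_mean_inner_harmVec {p : ℕ} (hp : 2 ≤ p) (K : ℕ)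
    (t : EuclideanSpace ℝ (HarmIdx p K)) :
    ((surfaceMeasure p).real Set.univ)⁻¹ *
      ∫ u, inner ℝ (harmVec hp K u) t ∂surfaceMeasure p = 0 := by
  simp_rw [inner_harmVec]
  rw [integral_finsetSum _ fun a _ => (integrable_sphHarm hp a.2.1).const_mul _, Finset.mul_sum]
  refine Finset.sum_eq_zero fun a _ => ?_
  rw [integral_const_mul, mul_left_comm,
    integral_sphHarm_eq_zero hp (HarmIdx.val_last_le hp a) (HarmIdx.val_ne_zero a), mul_zero]

theorem uniform_mean_inner_harmVec_sq {p : ℕ} (hp : 2 ≤ p) (K : ℕ)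
    (t : EuclideanSpace ℝ (HarmIdx p K)) :
    ((surfaceMeasure p).real Set.univ)⁻¹ *
      ∫ u, inner ℝ (harmVec hp K u) t ^ 2 ∂surfaceMeasure p = ‖t‖ ^ 2 := by
  have h : ∀ u, (inner ℝ (harmVec hp K u) t : ℝ) ^ 2 =
      ∑ a, ∑ b, t a * t b * (sphHarm hp a.2.1 u * sphHarm hp b.2.1 u) := fun u => by
    rw [inner_harmVec, sq, Finset.sum_mul_sum]
    exact Finset.sum_congr rfl fun a _ => Finset.sum_congr rfl fun b _ => by ring
  simp_rw [h]
  rw [integral_finsetSum _ fun a _ => integrable_finsetSum _ fun b _ =>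
    (integrable_sphHarm_mul hp _ _).const_mul _, Finset.mul_sum, EuclideanSpace.norm_sq_eq]
  refine Finset.sum_congr rfl fun a _ => ?_
  rw [integral_finsetSum _ fun b _ => (integrable_sphHarm_mul hp _ _).const_mul _, Finset.mul_sum,
    Finset.sum_eq_single a]
  · rw [integral_const_mul, mul_left_comm,
      sphHarm_orthonormal hp (HarmIdx.val_last_le hp a) (HarmIdx.val_last_le hp a), if_pos rfl,
      mul_one, Real.norm_eq_abs, sq_abs, sq]
  · intro b _ hb
    rw [integral_const_mul, mul_left_comm,
      sphHarm_orthonormal hp (HarmIdx.val_last_le hp a) (HarmIdx.val_last_le hp b),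
      if_neg fun h => hb (HarmIdx.ext_iff_val.1 h).symm, mul_zero]
  · simp

theorem harmMean_eq {p : ℕ} (hp : 2 ≤ p) (K : ℕ) {n : ℕ} (u : Fin n → USphere p) :
    harmMean hp K u = (n : ℝ)⁻¹ • ∑ i, harmVec hp K (u i) := rfl

end

/-! ### The limit theorem for the vector of harmonics -/

theorem mainTheorem8
    (p K : ℕ) (hp : 2 ≤ p) (hK : 0 < K)
    (κ : ℕ → ℝ) (hκpos : ∀ n : ℕ, 0 < κ n) (hκ : Tendsto κ atTop (𝓝 0))
    (f : ℝ → ℝ) (hf : IsAngularFunction f) (hfc : ContinuousAt f 0)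
    {Ω : ℕ → Type*} [∀ n, MeasurableSpace (Ω n)]
    (P : ∀ n, Measure (Ω n)) [∀ n, IsProbabilityMeasure (P n)]
    (U : ∀ n, Fin n → Ω n → USphere p)
    (hindep : ∀ n, iIndepFun (U n) (P n))
    (hlaw : ∀ (n : ℕ) (i : Fin n), HasLaw (U n i) (rotSymMeasure p (northPole p) (κ n) f) (P n)) :
    TendstoInDistribution
      (fun (n : ℕ) (ω : Ω n) => Real.sqrt (n : ℝ) •
        (harmMean hp K (fun i => U n i ω) - ∫ ω', harmMean hp K (fun i => U n i ω') ∂(P n)))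
      atTop
      (id : EuclideanSpace ℝ (HarmIdx p K) → EuclideanSpace ℝ (HarmIdx p K))
      P
      (stdGaussian (EuclideanSpace ℝ (HarmIdx p K))) := by
  obtain ⟨C, hC⟩ := exists_norm_harmVec_le hp K
  have hV := measurable_harmVec hp K
  set μ : ℕ → Measure (USphere p) := fun n => rotSymMeasure p (northPole p) (κ n) f
  have hmap : ∀ n (i : Fin n), (P n).map (U n i) = μ n := fun n i => (hlaw n i).map_eq
  have hprob : ∀ n, 0 < n → IsProbabilityMeasure (μ n) := fun n hn => by
    rw [← hmap n ⟨0, hn⟩]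
    exact Measure.isProbabilityMeasure_map (hlaw n ⟨0, hn⟩).aemeasurable
  set c : ℕ → EuclideanSpace ℝ (HarmIdx p K) := fun n => ∫ u, harmVec hp K u ∂μ n
  have hint : ∀ n, 0 < n → Integrable (harmVec hp K) (μ n) := fun n hn => by
    have := hprob n hn
    exact Integrable.of_bound hV.aestronglyMeasurable C (ae_of_all _ hC)
  have hcC : ∀ n, 0 < n → ‖c n‖ ≤ C := fun n hn => by
    have := hprob n hn
    exact (norm_integral_le_of_norm_le_const (ae_of_all _ hC)).trans (by simp)
  have hVc : ∀ n, Measurable fun u => harmVec hp K u - c n := fun n => hV.sub_const _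
  have hmean : ∀ n, 0 < n → ∀ t, ∫ u, inner ℝ (harmVec hp K u) t ∂μ n = inner ℝ (c n) t :=
    fun n hn t => by
      simp_rw [real_inner_comm t]
      exact integral_inner (hint n hn) t
  have hinnerb : ∀ t u, |(inner ℝ (harmVec hp K u) t : ℝ)| ≤ C * ‖t‖ := fun t u =>
    (abs_real_inner_le_norm _ _).trans (by gcongr; exact hC u)
  have hinnerm : ∀ t, Measurable fun u => (inner ℝ (harmVec hp K u) t : ℝ) := fun t =>
    hV.inner_const
  have hclt := tendstoInDistribution_stdGaussian_of_bounded_array P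
    (fun n i ω => harmVec hp K (U n i ω) - c n)
    (fun n => (μ n).map fun u => harmVec hp K u - c n)
    (fun n => (hindep n).comp (fun _ u => harmVec hp K u - c n) fun _ => hVc n)
    (fun n i => ⟨(hVc n).comp_aemeasurable (hlaw n i).aemeasurable, by
      rw [← hmap n i, AEMeasurable.map_map_of_aemeasurable (hVc n).aemeasurable
        (hlaw n i).aemeasurable]
      rfl⟩)
    (C + C)
    (fun n hn => by
      rw [ae_map_iff (hVc n).aemeasurable (measurableSet_le measurable_norm measurable_const)]
      exact ae_of_all _ fun u => (norm_sub_le _ _).trans (add_le_add (hC u) (hcC n hn)))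
    (fun n hn t => by
      have := hprob n hn
      rw [integral_map (hVc n).aemeasurable (by fun_prop)]
      simp_rw [inner_sub_left]
      rw [integral_sub ((hint n hn).inner_const t) (integrable_const _), hmean n hn]
      simp)
    -- The variance in direction `t` is the second moment, which tends to `‖t‖ ^ 2`, minus the
    -- squared mean, which tends to `0`.
    (fun t => by
      have h1 := tendsto_integral_rotSymMeasure (by omega : 0 < p) (northPole p) hκ hf hfc
        (hinnerm t) (hinnerb t)
      have h2 := tendsto_integral_rotSymMeasure (by omega : 0 < p) (northPole p) hκ hf hfc
        ((hinnerm t).pow_const 2) (C := (C * ‖t‖) ^ 2) fun u => by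
          rw [abs_pow]; exact pow_le_pow_left₀ (abs_nonneg _) (hinnerb t u) 2
      rw [uniform_mean_inner_harmVec] at h1
      rw [uniform_mean_inner_harmVec_sq] at h2
      have h3 := h2.sub (h1.pow 2)
      rw [zero_pow two_ne_zero, sub_zero] at h3
      refine h3.congr' ?_
      filter_upwards [eventually_gt_atTop 0] with n hn
      have := hprob n hn
      have i1 : Integrable (fun u => (inner ℝ (harmVec hp K u) t : ℝ)) (μ n) :=
        (hint n hn).inner_const t
      have i2 : Integrable (fun u => (inner ℝ (harmVec hp K u) t : ℝ) ^ 2) (μ n) :=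
        Integrable.of_bound ((hinnerm t).pow_const 2).aestronglyMeasurable ((C * ‖t‖) ^ 2)
          (ae_of_all _ fun u => by
            rw [norm_pow]; exact pow_le_pow_left₀ (norm_nonneg _) (hinnerb t u) 2)
      rw [integral_map (hVc n).aemeasurable (by fun_prop)]
      have e : ∀ u, (inner ℝ (harmVec hp K u - c n) t : ℝ) ^ 2 =
          inner ℝ (harmVec hp K u) t ^ 2 - 2 * inner ℝ (c n) t * inner ℝ (harmVec hp K u) t +
            inner ℝ (c n) t ^ 2 := fun u => by rw [inner_sub_left]; ring
      have i3 : Integrable (fun u => 2 * inner ℝ (c n) t * (inner ℝ (harmVec hp K u) t : ℝ))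
        (μ n) := i1.const_mul _
      have i4 : Integrable (fun u => (inner ℝ (harmVec hp K u) t : ℝ) ^ 2 -
        2 * inner ℝ (c n) t * inner ℝ (harmVec hp K u) t) (μ n) := i2.sub i3
      simp_rw [e]
      rw [integral_add i4 (integrable_const _), integral_sub i2 i3, integral_const_mul,
        hmean n hn]
      simp only [integral_const, probReal_univ, one_smul]
      ring)
  refine hclt.congr (fun n => ae_of_all _ fun ω => ?_) (ae_of_all _ fun _ => rfl)
  have hlawint : ∀ i, ∫ ω', harmVec hp K (U n i ω') ∂P n = c n := fun i => by
    change _ = ∫ u, harmVec hp K u ∂μ n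
    rw [← hmap n i, integral_map (hlaw n i).aemeasurable hV.aestronglyMeasurable]
  have hUint : ∀ i, Integrable (fun ω' => harmVec hp K (U n i ω')) (P n) := fun i =>
    Integrable.of_bound (hV.comp_aemeasurable (hlaw n i).aemeasurable).aestronglyMeasurable C
      (ae_of_all _ fun _ => hC _)
  simp only [harmMean_eq]
  rw [integral_smul, integral_finsetSum _ fun i _ => hUint i]
  simp only [hlawint, ← smul_sub, ← Finset.sum_sub_distrib, smul_smul]
  congr 1
  -- The scalars agree also for `n = 0`, where both are `0` by the convention on division.
  rw [← div_eq_mul_inv, Real.sqrt_div_self', one_div]
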